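/- Let $G$ be a (finite-dimensional, real, smooth) Lie group and $H\subset G$ a closed subgroup, and let $M=G/H$ be the homogeneous space with the quotient topology and its usual smooth structure, i.e. the unique one for which the projection $\pi:G\to G/H$ is a smooth submersion; put $n=\dim M$. An asymmetric norm on a real vector space $V$ is a function $F:V\to[0,\infty)$ with $F(y)=0\iff y=0$, $F(\lambda y)=\lambda F(y)$ for $\lambda>0$, and $F(y+z)\le F(y)+F(z)$. It is strongly convex if there is an asymmetric norm $\check F$ on $V$ such that $$F^2(z)\ge F^2(y)+\alpha(z-y)+\check F^2(z-y)$$ for all $y,z\in V$ and all $\alpha\in\partial F^2(y)=\{\alpha\in V^*: F^2(z)\ge F^2(y)+\alpha(z-y)\ \forall z\in V\}$. A $C^0$-Finsler structure on $M$ is a continuous function $F:TM\to[0,\infty)$ whose restriction $F(x,\cdot)$ to each tangent space $T_xM$ is an asymmetric norm. A $C^0$-Finsler structure $F$ is of Pontryagin type if every $p\in M$ lies in the domain $U$ of a smooth chart $\varphi=(x^1,\dots,x^n)$ for which there is a family $\{X_u=\sum_i f^i(\cdot,u)\,\partial/\partial x^i;\ u\in S^{n-1}\}$ of $C^1$ vector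 fields on $U$, indexed by the Euclidean unit sphere $S^{n-1}\subset\mathbb R^n$, such that: (1) for each $x\in U$, $u\mapsto X_u(x)$ is a homeomorphism of $S^{n-1}$ onto the unit sphere $\{y\in T_xM: F(x,y)=1\}$; (2) $(x,u)\mapsto f^i(x,u)$ is continuous for every $i$; (3) $(x,u)\mapsto \frac{\partial f^j}{\partial x^i}(x,u)$ is continuous for all $i,j$. Call $(\varphi,\{X_u\})$ an admissible family. Its extended geodesic field associates with each $(x,\alpha)\in T^*U\setminus 0$ the set $$\mathcal E(x,\alpha)=\{\vec H_u(x,\alpha):\ u\in S^{n-1},\ \alpha(X_u(x))=\max_{v\in S^{n-1}}\alpha(X_v(x))\}\subset T_{(x,\alpha)}(T^*M),$$ where $\vec H_u$ is the Hamiltonian vector field of $H_u(x,\alpha)=\alpha(X_u(x))$, that is, in the natural coordinates $(x^i,\alpha_i)$ of $T^*U$, $$\vec H_u=\sum_i f^i(x,u)\frac{\partial}{\partial x^i}-\sum_{i}\Big(\sum_j\alpha_j\frac{\partial f^j}{\partial x^i}(x,u)\Big)\frac{\partial}{\partial\alpha_i}.$$ Theorem. Let $F$ be a $G$-invariant $C^0$-Finsler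 structure on $M=G/H$, i.e. $F(gx,d(a_g)_x(y))=F(x,y)$ for all $g\in G$, $x\in M$, $y\in T_xM$, where $a_g(x)=gx$. Then $F$ is of Pontryagin type. If moreover the restriction of $F$ to some tangent space $T_{x_0}M$ is strongly convex, then the extended geodesic field is a locally Lipschitz vector field on $T^*M\setminus 0$: there is a vector field $V$ on $T^*M\setminus 0$, whose components in the natural coordinates of every smooth chart of $M$ are locally Lipschitz functions, such that $\mathcal E(x,\alpha)=\{V(x,\alpha)\}$ for every admissible family $(\varphi,\{X_u\})$ and every $(x,\alpha)\in T^*M\setminus 0$ with $x$ in the domain of $\varphi$. -/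

import Mathlib

open scoped Manifold ContDiff Topology

noncomputable section

/-! ### Asymmetric norms -/

/-- An asymmetric norm on a real vector space. -/
structure IsAsymmetricNorm {V : Type*} [AddCommGroup V] [Module ℝ V] (F : V → ℝ) : Prop where
  nonneg : ∀ y, 0 ≤ F y
  eq_zero_iff : ∀ y, F y = 0 ↔ y = 0
  pos_homogeneous : ∀ (c : ℝ) (y : V), 0 < c → F (c • y) = c * F y
  triangle : ∀ y z, F (y + z) ≤ F y + F z

/-- The subdifferential `∂F²(y)`: the linear functionals `a` with
`F²(z) ≥ F²(y) + a (z - y)` for all `z`. -/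
def subdifferentialSq {V : Type*} [AddCommGroup V] [Module ℝ V] (F : V → ℝ) (y : V) :
    Set (V →ₗ[ℝ] ℝ) :=
  {a | ∀ z, F y ^ 2 + a (z - y) ≤ F z ^ 2}

/-- `F` is strongly convex with respect to `F'`. -/
def StronglyConvexWrt {V : Type*} [AddCommGroup V] [Module ℝ V] (F F' : V → ℝ) : Prop :=
  ∀ y z : V, ∀ a ∈ subdifferentialSq F y, F y ^ 2 + a (z - y) + F' (z - y) ^ 2 ≤ F z ^ 2

/-- `F` is a strongly convex asymmetric norm: it is strongly convex with respect to some
asymmetric norm. -/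
def IsStronglyConvexAsymmetricNorm {V : Type*} [AddCommGroup V] [Module ℝ V] (F : V → ℝ) : Prop :=
  IsAsymmetricNorm F ∧ ∃ F' : V → ℝ, IsAsymmetricNorm F' ∧ StronglyConvexWrt F F'

/-! ### `C⁰`-Finsler structures of Pontryagin type -/

section Manifold

variable {n : ℕ} {M : Type*} [TopologicalSpace M] [ChartedSpace (EuclideanSpace ℝ (Fin n)) M]

/-- A `C⁰`-Finsler structure on an `n`-dimensional manifold `M`: a continuous function on `TM`
which is an asymmetric norm on every tangent space. -/
structure IsC0Finsler [IsManifold (𝓡 n) ∞ M] (F : TangentBundle (𝓡 n) M → ℝ) : Prop where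
  continuous : Continuous F
  asymmetricNorm : ∀ x : M, IsAsymmetricNorm (fun y : TangentSpace (𝓡 n) x => F ⟨x, y⟩)

/-- The coordinates `ξ ↦ (y¹(ξ), …, yⁿ(ξ))` of a vector field `X` in the natural chart of the
tangent bundle given by the chart `φ`, as a function of the coordinates `ξ` of the base point. -/
def fieldInChart (φ : OpenPartialHomeomorph M (EuclideanSpace ℝ (Fin n)))
    (X : (x : M) → TangentSpace (𝓡 n) x) (ξ : EuclideanSpace ℝ (Fin n)) :
    EuclideanSpace ℝ (Fin n) :=
  mfderiv (𝓡 n) (𝓡 n) φ (φ.symm ξ) (X (φ.symm ξ))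

/-- The conditions on a family `{X_u ; u ∈ Sⁿ⁻¹}` of `C¹` unit vector fields on the domain of the
chart `φ` which define Pontryagin type. -/
structure IsPontryaginFamily (F : TangentBundle (𝓡 n) M → ℝ)
    (φ : OpenPartialHomeomorph M (EuclideanSpace ℝ (Fin n)))
    (X : Metric.sphere (0 : EuclideanSpace ℝ (Fin n)) 1 → (x : M) → TangentSpace (𝓡 n) x) :
    Prop where
  contDiffOn : ∀ u, ContDiffOn ℝ 1 (fieldInChart φ (X u)) φ.target
  /-- `u ↦ X_u(x)` is a homeomorphism of `Sⁿ⁻¹` onto its image ... -/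
  isEmbedding : ∀ x ∈ φ.source, Topology.IsEmbedding (fun u => X u x)
  /-- ... and this image is the unit sphere of `F(x, ·)`. -/
  range_eq : ∀ x ∈ φ.source,
    Set.range (fun u => X u x) = {y : TangentSpace (𝓡 n) x | F ⟨x, y⟩ = 1}
  continuousOn : ContinuousOn
    (fun q : EuclideanSpace ℝ (Fin n) × Metric.sphere (0 : EuclideanSpace ℝ (Fin n)) 1 =>
      fieldInChart φ (X q.2) q.1) (φ.target ×ˢ Set.univ)
  /-- All partial derivatives with respect to the base point are continuous in `(x, u)`. -/
  continuousOn_deriv : ContinuousOn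
    (fun q : EuclideanSpace ℝ (Fin n) × Metric.sphere (0 : EuclideanSpace ℝ (Fin n)) 1 =>
      fderiv ℝ (fieldInChart φ (X q.2)) q.1) (φ.target ×ˢ Set.univ)

/-- `F` is of Pontryagin type at `p`. -/
def IsPontryaginTypeAt (F : TangentBundle (𝓡 n) M → ℝ) (p : M) : Prop :=
  ∃ φ ∈ IsManifold.maximalAtlas (𝓡 n) ∞ M, p ∈ φ.source ∧
    ∃ X : Metric.sphere (0 : EuclideanSpace ℝ (Fin n)) 1 → (x : M) → TangentSpace (𝓡 n) x,
      IsPontryaginFamily F φ X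

/-- `F` is of Pontryagin type on `M`. -/
def IsPontryaginType (F : TangentBundle (𝓡 n) M → ℝ) : Prop :=
  ∀ p : M, IsPontryaginTypeAt F p

/-! ### The cotangent bundle and the extended geodesic field -/

/-- The dual space of `ℝⁿ`. -/
abbrev DualModel (n : ℕ) : Type := EuclideanSpace ℝ (Fin n) →L[ℝ] ℝ

variable (M) in
/-- The cotangent bundle of `M`, with the vector bundle and manifold structure of the bundle of
continuous linear maps from `TM` to the trivial line bundle. -/
abbrev CotangentBundle [IsManifold (𝓡 n) ∞ M] : Type _ :=
  Bundle.TotalSpace (DualModel n)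
    (fun x : M => TangentSpace (𝓡 n) x →L[ℝ] Bundle.Trivial M ℝ x)

/-- The model with corners of the cotangent bundle. -/
abbrev cotangentModel (n : ℕ) :
    ModelWithCorners ℝ (EuclideanSpace ℝ (Fin n) × DualModel n)
      (ModelProd (EuclideanSpace ℝ (Fin n)) (DualModel n)) :=
  (𝓡 n).prod 𝓘(ℝ, DualModel n)

variable [IsManifold (𝓡 n) ∞ M]

/-- The natural coordinates `(x, α) ↦ (x¹, …, xⁿ, α₁, …, αₙ)` on `T*M` given by a chart `φ` of
`M`; the covector `∑ αᵢ dxⁱ` is recorded as the functional `α ∘ (dφₓ)⁻¹` on `ℝⁿ`. -/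
def cotangentCoord (φ : OpenPartialHomeomorph M (EuclideanSpace ℝ (Fin n)))
    (p : CotangentBundle (n := n) M) : EuclideanSpace ℝ (Fin n) × DualModel n :=
  (φ p.1, ContinuousLinearMap.comp (p.2 : TangentSpace (𝓡 n) p.1 →L[ℝ] ℝ)
    (mfderiv (𝓡 n) (𝓡 n) φ p.1).inverse)

/-- The inverse of `cotangentCoord φ`. -/
def cotangentCoordSymm (φ : OpenPartialHomeomorph M (EuclideanSpace ℝ (Fin n)))
    (ζ : EuclideanSpace ℝ (Fin n) × DualModel n) : CotangentBundle (n := n) M :=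
  ⟨φ.symm ζ.1, ContinuousLinearMap.comp (ζ.2 : EuclideanSpace ℝ (Fin n) →L[ℝ] ℝ)
    (mfderiv (𝓡 n) (𝓡 n) φ (φ.symm ζ.1))⟩

/-- The components, in the natural coordinates of `T*M` given by `φ`, of a tangent vector `w` of
`T*M` at `p`. -/
def cotangentComponents (φ : OpenPartialHomeomorph M (EuclideanSpace ℝ (Fin n)))
    (p : CotangentBundle (n := n) M) (w : TangentSpace (cotangentModel n) p) :
    EuclideanSpace ℝ (Fin n) × DualModel n :=
  mfderiv (cotangentModel n) 𝓘(ℝ, EuclideanSpace ℝ (Fin n) × DualModel n)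
    (cotangentCoord φ) p w

/-- The components in natural coordinates of the Hamiltonian vector field of `H(x, α) = α (X x)`:
`fⁱ ∂/∂xⁱ - αⱼ (∂fʲ/∂xⁱ) ∂/∂αᵢ`, where `f` are the components of `X`. -/
def hamiltonianComponents (φ : OpenPartialHomeomorph M (EuclideanSpace ℝ (Fin n)))
    (X : (x : M) → TangentSpace (𝓡 n) x) (ζ : EuclideanSpace ℝ (Fin n) × DualModel n) :
    EuclideanSpace ℝ (Fin n) × DualModel n :=
  (fieldInChart φ X ζ.1, -(ζ.2.comp (fderiv ℝ (fieldInChart φ X) ζ.1)))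

/-- The Hamiltonian `H_u(x, α) = α (X_u(x))`. -/
def controlHamiltonian
    (X : Metric.sphere (0 : EuclideanSpace ℝ (Fin n)) 1 → (x : M) → TangentSpace (𝓡 n) x)
    (u : Metric.sphere (0 : EuclideanSpace ℝ (Fin n)) 1) (p : CotangentBundle (n := n) M) : ℝ :=
  (p.2 : TangentSpace (𝓡 n) p.1 →L[ℝ] ℝ) (X u p.1)

/-- The controls `u` which maximize `H_u(x, α)`. -/
def maximizingControls
    (X : Metric.sphere (0 : EuclideanSpace ℝ (Fin n)) 1 → (x : M) → TangentSpace (𝓡 n) x)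
    (p : CotangentBundle (n := n) M) : Set (Metric.sphere (0 : EuclideanSpace ℝ (Fin n)) 1) :=
  {u | ∀ v, controlHamiltonian X v p ≤ controlHamiltonian X u p}

/-- The extended geodesic field of the family `X_u` on the domain of the chart `φ`: the set of the
Hamiltonian vectors of `H_u` at `p`, where `u` runs through the maximizing controls. A tangent
vector of `T*M` is determined by its components in the natural coordinates. -/
def extendedGeodesicField (φ : OpenPartialHomeomorph M (EuclideanSpace ℝ (Fin n)))
    (X : Metric.sphere (0 : EuclideanSpace ℝ (Fin n)) 1 → (x : M) → TangentSpace (𝓡 n) x)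
    (p : CotangentBundle (n := n) M) : Set (TangentSpace (cotangentModel n) p) :=
  {w | ∃ u ∈ maximizingControls X p,
    cotangentComponents φ p w = hamiltonianComponents φ (X u) (cotangentCoord φ p)}

/-- A vector field on `T*M ∖ 0` (its values on the zero section are irrelevant) is locally
Lipschitz if its components in all natural coordinates are locally Lipschitz functions. -/
def IsLocallyLipschitzOffZero
    (V : (p : CotangentBundle (n := n) M) → TangentSpace (cotangentModel n) p) : Prop :=
  ∀ φ ∈ IsManifold.maximalAtlas (𝓡 n) ∞ M,
    LocallyLipschitzOn (φ.target ×ˢ {0}ᶜ)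
      (fun ζ : EuclideanSpace ℝ (Fin n) × DualModel n =>
        cotangentComponents φ (cotangentCoordSymm φ ζ) (V (cotangentCoordSymm φ ζ)))

end Manifold

end

/-! Homogeneity lets one fixed norm describe `F` near any point. A submersion has smooth local
sections, so near `p` there is a smooth family of group elements carrying `p` to the nearby points.
In a chart, the differentials of these translations at `p` form a smooth family of linear
isomorphisms `A ξ`, and invariance says that each `A ξ` carries `F(p, ·)` to `F` at the point with
coordinates `ξ` (`hasLocalFrameAt_of_invariant`). If `Y` parametrizes the unit sphere at `p`
radially, then `X_u = A Y(u)` is an admissible family, so `F` is of Pontryagin type.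

Under strong convexity, which invariance spreads from one tangent space to all, let `N = F(p, ·)`. A
nonzero covector `b` attains its maximum on the unit sphere of `N` at a single point, which depends
on `b` in a locally Lipschitz way (`exists_norm_sub_mul_le`). Moreover the maximum itself is
differentiable in `b`, with derivative the evaluation at that point
(`hasFDerivAt_apply_unitMaximizer`). The maximized Hamiltonian is `H(ξ, α) = N*(α ∘ A ξ)`, where
`N*` denotes this maximum, so it is differentiable off the zero section and its Hamiltonian field is
locally Lipschitz.

`H` is defined from `F` alone and cotangent transition maps are symplectic, so its Hamiltonian field
`V` does not depend on the chart. For any admissible family, `H_u ≤ H`, with equality at `(x, α)`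
when `u` is a maximizing control there. Hence `H - H_u` has a local minimum at that point, the two
differentials agree, and the Hamiltonian vector of `H_u` is `V(x, α)`. Every maximizing control
therefore gives the same vector (`extendedGeodesicField_eq_singleton`). -/

noncomputable section

/-! ### Asymmetric norms, and maximizers of functionals on their unit spheres. -/

section AsymmetricNorm

namespace IsAsymmetricNorm

variable {E : Type*} [NormedAddCommGroup E] [NormedSpace ℝ E] {F : E → ℝ}

lemma map_zero (hF : IsAsymmetricNorm F) : F 0 = 0 := (hF.eq_zero_iff 0).2 rfl

lemma pos (hF : IsAsymmetricNorm F) {y : E} (hy : y ≠ 0) : 0 < F y :=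
  lt_of_le_of_ne (hF.nonneg y) fun h => hy ((hF.eq_zero_iff y).1 h.symm)

lemma ne_zero_of_eq_one (hF : IsAsymmetricNorm F) {y : E} (hy : F y = 1) : y ≠ 0 := by
  rintro rfl
  rw [hF.map_zero] at hy
  exact zero_ne_one hy

lemma smul_of_nonneg (hF : IsAsymmetricNorm F) {c : ℝ} (hc : 0 ≤ c) (y : E) :
    F (c • y) = c * F y := by
  rcases hc.eq_or_lt with rfl | hc
  · simp [hF.map_zero]
  · exact hF.pos_homogeneous c y hc

lemma map_inv_smul_self (hF : IsAsymmetricNorm F) {y : E} (hy : y ≠ 0) :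
    F ((F y)⁻¹ • y) = 1 := by
  rw [hF.pos_homogeneous _ _ (inv_pos.2 (hF.pos hy)), inv_mul_cancel₀ (hF.pos hy).ne']

lemma convexOn (hF : IsAsymmetricNorm F) : ConvexOn ℝ Set.univ F := by
  refine ⟨convex_univ, fun x _ y _ a b ha hb _ => ?_⟩
  rw [smul_eq_mul, smul_eq_mul, ← hF.smul_of_nonneg ha, ← hF.smul_of_nonneg hb]
  exact hF.triangle _ _

lemma continuous [FiniteDimensional ℝ E] (hF : IsAsymmetricNorm F) : Continuous F :=
  hF.convexOn.locallyLipschitz.continuous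

lemma map_eq_norm_mul (hF : IsAsymmetricNorm F) (y : E) : F y = ‖y‖ * F (‖y‖⁻¹ • y) := by
  rcases eq_or_ne y 0 with rfl | hy
  · simp [hF.map_zero]
  · rw [hF.smul_of_nonneg (by positivity), mul_inv_cancel_left₀ (norm_ne_zero_iff.2 hy)]

lemma exists_mul_norm_le [FiniteDimensional ℝ E] (hF : IsAsymmetricNorm F) :
    ∃ c > 0, ∀ y, c * ‖y‖ ≤ F y := by
  have : ∃ c > 0, ∀ y ∈ Metric.sphere (0 : E) 1, c ≤ F y := by
    rcases (Metric.sphere (0 : E) 1).eq_empty_or_nonempty with h | h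
    -- In dimension zero the sphere is empty and any positive constant will do.
    · exact ⟨1, one_pos, by simp [h]⟩
    · obtain ⟨x, hx, hmin⟩ :=
        (isCompact_sphere (0 : E) 1).exists_isMinOn h hF.continuous.continuousOn
      exact ⟨F x, hF.pos (ne_zero_of_mem_unit_sphere ⟨x, hx⟩), fun y hy => hmin hy⟩
  obtain ⟨c, hc, h⟩ := this
  refine ⟨c, hc, fun y => ?_⟩
  rcases eq_or_ne y 0 with rfl | hy
  · simp [hF.map_zero]
  · rw [hF.map_eq_norm_mul y, mul_comm]
    refine mul_le_mul_of_nonneg_left (h _ ?_) (norm_nonneg y)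
    simp [norm_smul, hy]

lemma exists_le_mul_norm [FiniteDimensional ℝ E] (hF : IsAsymmetricNorm F) :
    ∃ C > 0, ∀ y, F y ≤ C * ‖y‖ := by
  obtain ⟨C, hC⟩ := ((isCompact_sphere (0 : E) 1).image hF.continuous).bddAbove
  refine ⟨max C 1, by positivity, fun y => ?_⟩
  rcases eq_or_ne y 0 with rfl | hy
  · simp [hF.map_zero]
  · rw [hF.map_eq_norm_mul y, mul_comm]
    refine mul_le_mul_of_nonneg_right (le_trans (hC ⟨_, ?_, rfl⟩) (le_max_left _ _)) (norm_nonneg y)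
    simp [norm_smul, hy]

lemma isCompact_unitSphere [FiniteDimensional ℝ E] (hF : IsAsymmetricNorm F) :
    IsCompact {y | F y = 1} := by
  obtain ⟨c, hc, h⟩ := hF.exists_mul_norm_le
  refine Metric.isCompact_of_isClosed_isBounded (isClosed_eq hF.continuous continuous_const) ?_
  refine (Metric.isBounded_closedBall (x := (0 : E)) (r := c⁻¹)).subset fun y hy => ?_
  rw [mem_closedBall_zero_iff, ← one_div, le_div_iff₀ hc, mul_comm]
  exact (h y).trans_eq hy

end IsAsymmetricNorm

lemma IsAsymmetricNorm.comp_linearEquiv {V W : Type*} [AddCommGroup V] [Module ℝ V]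
    [AddCommGroup W] [Module ℝ W] {F : W → ℝ} (hF : IsAsymmetricNorm F) (L : V ≃ₗ[ℝ] W) :
    IsAsymmetricNorm (fun v => F (L v)) :=
  ⟨fun y => hF.nonneg _, fun y => by rw [hF.eq_zero_iff]; simp,
    fun c y hc => by rw [map_smul, hF.pos_homogeneous _ _ hc],
    fun y z => by rw [map_add]; exact hF.triangle _ _⟩

lemma IsStronglyConvexAsymmetricNorm.comp_linearEquiv {V W : Type*} [AddCommGroup V] [Module ℝ V]
    [AddCommGroup W] [Module ℝ W] {F : W → ℝ} (hF : IsStronglyConvexAsymmetricNorm F)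
    (L : V ≃ₗ[ℝ] W) : IsStronglyConvexAsymmetricNorm (fun v => F (L v)) := by
  obtain ⟨h, F', hF', hs⟩ := hF
  refine ⟨h.comp_linearEquiv L, fun v => F' (L v), hF'.comp_linearEquiv L, fun y z a ha => ?_⟩
  have := hs (L y) (L z) (a ∘ₗ L.symm.toLinearMap) fun w => by
    simpa using ha (L.symm w)
  simpa using this

section Maximizer

variable {E : Type*} [NormedAddCommGroup E] [NormedSpace ℝ E] {F : E → ℝ}

/-- `y` maximizes the functional `b` on the unit sphere of `F`. -/
def IsUnitMaximizer (F : E → ℝ) (b : E →L[ℝ] ℝ) (y : E) : Prop :=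
  F y = 1 ∧ ∀ z, F z = 1 → b z ≤ b y

lemma IsUnitMaximizer.le_mul (hF : IsAsymmetricNorm F) {b : E →L[ℝ] ℝ} {y : E}
    (hy : IsUnitMaximizer F b y) (z : E) : b z ≤ b y * F z := by
  rcases eq_or_ne z 0 with rfl | hz
  · simp [hF.map_zero]
  · have := hy.2 _ (hF.map_inv_smul_self hz)
    rw [map_smul, smul_eq_mul, inv_mul_le_iff₀ (hF.pos hz), mul_comm] at this
    exact this

lemma exists_isUnitMaximizer [FiniteDimensional ℝ E] (hF : IsAsymmetricNorm F) {b : E →L[ℝ] ℝ}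
    (hb : b ≠ 0) : ∃ y, IsUnitMaximizer F b y := by
  obtain ⟨v, hv⟩ : ∃ v, b v ≠ 0 := by
    by_contra! h
    exact hb (ContinuousLinearMap.ext h)
  have hv0 : v ≠ 0 := by rintro rfl; simp at hv
  obtain ⟨y, hy, hmax⟩ := hF.isCompact_unitSphere.exists_isMaxOn ⟨_, hF.map_inv_smul_self hv0⟩
    b.continuous.continuousOn
  exact ⟨y, hy, fun z hz => hmax hz⟩

/-- From `b ≤ b y * F` and `F ≤ C‖·‖`: the maximal value is comparable to the operator norm from
below, uniformly in `b`. -/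
lemma exists_norm_le_mul_of_isUnitMaximizer [FiniteDimensional ℝ E] (hF : IsAsymmetricNorm F) :
    ∃ C > 0, ∀ (b : E →L[ℝ] ℝ) (y : E), b ≠ 0 → IsUnitMaximizer F b y →
      0 < b y ∧ ‖b‖ ≤ C * b y := by
  obtain ⟨C, hC, h⟩ := hF.exists_le_mul_norm
  refine ⟨C, hC, fun b y hb hy => ?_⟩
  have hpos : 0 < b y := by
    obtain ⟨v, hv⟩ : ∃ v, 0 < b v := by
      by_contra! h0
      refine hb (ContinuousLinearMap.ext fun v => le_antisymm (h0 v) ?_)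
      simpa using h0 (-v)
    have := hv.trans_le (hy.le_mul hF v)
    exact pos_of_mul_pos_left this (hF.nonneg v)
  refine ⟨hpos, b.opNorm_le_bound (by positivity) fun v => ?_⟩
  have key : ∀ v, b v ≤ C * b y * ‖v‖ := fun v => by
    refine (hy.le_mul hF v).trans ?_
    rw [mul_comm C, mul_assoc]
    exact mul_le_mul_of_nonneg_left (h v) hpos.le
  rw [Real.norm_eq_abs, abs_le']
  exact ⟨key v, by simpa using key (-v)⟩

/-- Strong convexity at a maximizer makes `b` fall off quadratically along the unit sphere. Adding
this inequality for `b` at `y` to the one for `b'` at `y'` leaves `2 (b' - b) (y' - y)` on the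
right, which is linear in `‖y' - y‖`; cancelling one factor gives the estimate. With `b' = b` it
yields uniqueness of the maximizer. -/
lemma IsStronglyConvexAsymmetricNorm.exists_norm_sub_mul_le [FiniteDimensional ℝ E]
    (hF : IsStronglyConvexAsymmetricNorm F) :
    ∃ K > 0, ∀ (b b' : E →L[ℝ] ℝ) (y y' : E), b ≠ 0 → b' ≠ 0 → IsUnitMaximizer F b y →
      IsUnitMaximizer F b' y' → ‖y' - y‖ * ‖b‖ ≤ K * ‖b' - b‖ := by
  obtain ⟨hF, F', hF', hs⟩ := hF
  obtain ⟨C, hC, hCb⟩ := exists_norm_le_mul_of_isUnitMaximizer hF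
  obtain ⟨c, hc, hcF⟩ := hF'.exists_mul_norm_le
  have key : ∀ (b : E →L[ℝ] ℝ) (y z : E), b ≠ 0 → IsUnitMaximizer F b y → F z = 1 →
      b y * (c * ‖z - y‖) ^ 2 ≤ 2 * (b y - b z) := by
    intro b y z hb hy hz
    have hpos := (hCb b y hb hy).1
    -- The functional `2b / b(y)` is a subgradient of `F²` at `y`, since `F² ≥ 2F - 1 ≥ 2b / b(y) -
    -- 1`.
    have h1 := hs y z ((2 / b y) • b.toLinearMap) (fun w => by
      have h2 : b w / b y ≤ F w := by
        rw [div_le_iff₀ hpos, mul_comm]; exact hy.le_mul hF w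
      have h3 : 2 / b y * b w - 2 / b y * b y = 2 * (b w / b y) - 2 := by field_simp
      simp only [LinearMap.smul_apply, ContinuousLinearMap.coe_coe, map_sub, smul_eq_mul, hy.1]
      rw [h3]
      nlinarith [sq_nonneg (F w - 1)])
    have h4 : (c * ‖z - y‖) ^ 2 ≤ F' (z - y) ^ 2 :=
      pow_le_pow_left₀ (by positivity) (hcF _) 2
    simp only [LinearMap.smul_apply, ContinuousLinearMap.coe_coe, map_sub, smul_eq_mul, hy.1,
      hz] at h1
    have h5 : (c * ‖z - y‖) ^ 2 ≤ 2 / b y * (b y - b z) := by linarith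
    calc b y * (c * ‖z - y‖) ^ 2 ≤ b y * (2 / b y * (b y - b z)) :=
          mul_le_mul_of_nonneg_left h5 hpos.le
      _ = 2 * (b y - b z) := by field_simp
  refine ⟨2 * C / c ^ 2, by positivity, fun b b' y y' hb hb' hy hy' => ?_⟩
  have h1 := key b y y' hb hy hy'.1
  have h2 := key b' y' y hb' hy' hy.1
  rw [norm_sub_rev] at h2
  have h3 : 0 ≤ b' y' * (c * ‖y' - y‖) ^ 2 :=
    mul_nonneg (hCb b' y' hb' hy').1.le (sq_nonneg _)
  have h4 : (b' - b) (y' - y) ≤ ‖b' - b‖ * ‖y' - y‖ :=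
    (le_abs_self _).trans ((b' - b).le_opNorm _)
  have h5 : b y * (c * ‖y' - y‖) ^ 2 ≤ 2 * (‖b' - b‖ * ‖y' - y‖) := by
    simp only [sub_apply, map_sub] at h4
    linarith
  rcases (norm_nonneg (y' - y)).eq_or_lt with h0 | h0
  · rw [← h0]; simp only [zero_mul]; positivity
  · have h6 : b y * c ^ 2 * ‖y' - y‖ ≤ 2 * ‖b' - b‖ := by
      refine le_of_mul_le_mul_right ?_ h0
      linarith [h5, show b y * c ^ 2 * ‖y' - y‖ * ‖y' - y‖ = b y * (c * ‖y' - y‖) ^ 2 by ring]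
    rw [div_mul_eq_mul_div, le_div_iff₀ (by positivity)]
    calc ‖y' - y‖ * ‖b‖ * c ^ 2 ≤ ‖y' - y‖ * (C * b y) * c ^ 2 := by
          gcongr; exact (hCb b y hb hy).2
      _ = C * (b y * c ^ 2 * ‖y' - y‖) := by ring
      _ ≤ C * (2 * ‖b' - b‖) := by gcongr
      _ = 2 * C * ‖b' - b‖ := by ring

open Classical in
/-- A point of the unit sphere of `F` at which `b` is maximal (and `0` if there is none). -/
def unitMaximizer (F : E → ℝ) (b : E →L[ℝ] ℝ) : E :=
  if h : ∃ y, IsUnitMaximizer F b y then h.choose else 0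

lemma isUnitMaximizer_unitMaximizer [FiniteDimensional ℝ E] (hF : IsAsymmetricNorm F)
    {b : E →L[ℝ] ℝ} (hb : b ≠ 0) : IsUnitMaximizer F b (unitMaximizer F b) := by
  have h := exists_isUnitMaximizer hF hb
  rw [unitMaximizer, dif_pos h]
  exact h.choose_spec

lemma eventually_ne_and_half_le {b : E →L[ℝ] ℝ} (hb : b ≠ 0) :
    ∀ᶠ b' in 𝓝 b, b' ≠ 0 ∧ ‖b‖ / 2 ≤ ‖b'‖ := by
  have h : ∀ᶠ b' in 𝓝 b, ‖b‖ / 2 < ‖b'‖ :=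
    continuous_norm.continuousAt.eventually (lt_mem_nhds (half_lt_self (norm_pos_iff.2 hb)))
  filter_upwards [h, isOpen_ne.mem_nhds hb] with b' h1 h2 using ⟨h2, h1.le⟩

/-- The Lipschitz bound degenerates only as the covector tends to zero; where norms stay above `‖b‖
/ 2` the constant `2K / ‖b‖` works. -/
lemma IsStronglyConvexAsymmetricNorm.locallyLipschitzOn_unitMaximizer [FiniteDimensional ℝ E]
    (hF : IsStronglyConvexAsymmetricNorm F) :
    ∀ b : E →L[ℝ] ℝ, b ≠ 0 → ∃ K, ∃ t ∈ 𝓝 b, LipschitzOnWith K (unitMaximizer F) t := by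
  intro b hb
  obtain ⟨K, hK, h⟩ := hF.exists_norm_sub_mul_le
  have hb0 := norm_pos_iff.2 hb
  refine ⟨(2 * K / ‖b‖).toNNReal, _, eventually_ne_and_half_le hb,
    LipschitzOnWith.of_dist_le_mul fun b₁ h1 b₂ h2 => ?_⟩
  rw [dist_eq_norm, dist_eq_norm, Real.coe_toNNReal _ (by positivity), div_mul_eq_mul_div,
    le_div_iff₀ hb0]
  have := h b₂ b₁ _ _ h2.1 h1.1 (isUnitMaximizer_unitMaximizer hF.1 h2.1)
    (isUnitMaximizer_unitMaximizer hF.1 h1.1)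
  have h3 := mul_le_mul_of_nonneg_left h2.2 (norm_nonneg (unitMaximizer F b₁ - unitMaximizer F b₂))
  linarith

/-- An envelope argument. With `y`, `y'` the maximizers of `b`, `b'`, the first-order error is
`b'(y') - b'(y)`. It is nonnegative because `y'` maximizes `b'`, and at most `(b' - b)(y' - y)`
because `y` maximizes `b`. The Lipschitz estimate makes this quadratic in `‖b' - b‖`. -/
lemma IsStronglyConvexAsymmetricNorm.hasFDerivAt_apply_unitMaximizer [FiniteDimensional ℝ E]
    (hF : IsStronglyConvexAsymmetricNorm F) {b : E →L[ℝ] ℝ} (hb : b ≠ 0) :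
    HasFDerivAt (fun b : E →L[ℝ] ℝ => b (unitMaximizer F b))
      (ContinuousLinearMap.apply ℝ ℝ (unitMaximizer F b)) b := by
  obtain ⟨K, hK, h⟩ := hF.exists_norm_sub_mul_le
  have hb0 := norm_pos_iff.2 hb
  refine HasFDerivAt.of_isLittleO ?_
  have hO : (fun b' : E →L[ℝ] ℝ => b' (unitMaximizer F b') - b (unitMaximizer F b) -
      ContinuousLinearMap.apply ℝ ℝ (unitMaximizer F b) (b' - b)) =O[𝓝 b]
      fun b' => ‖b' - b‖ * ‖b' - b‖ := by
    refine Asymptotics.IsBigO.of_bound (K / ‖b‖) ?_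
    filter_upwards [isOpen_ne.mem_nhds hb] with b' hb'
    have hy := isUnitMaximizer_unitMaximizer hF.1 hb
    have hy' := isUnitMaximizer_unitMaximizer hF.1 hb'
    have h1 := hy.2 _ hy'.1
    have h2 := hy'.2 _ hy.1
    have h3 := h b b' _ _ hb hb' hy hy'
    have h4 : (b' - b) (unitMaximizer F b' - unitMaximizer F b) ≤
        ‖b' - b‖ * ‖unitMaximizer F b' - unitMaximizer F b‖ :=
      (le_abs_self _).trans ((b' - b).le_opNorm _)
    simp only [ContinuousLinearMap.apply_apply, sub_apply, map_sub] at h4 ⊢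
    rw [Real.norm_of_nonneg (by linarith), Real.norm_of_nonneg (by positivity)]
    calc _ ≤ ‖b' - b‖ * ‖unitMaximizer F b' - unitMaximizer F b‖ := by linarith
      _ ≤ ‖b' - b‖ * (K * ‖b' - b‖ / ‖b‖) := by
        gcongr
        rwa [le_div_iff₀ hb0]
      _ = _ := by ring
  refine hO.trans_isLittleO ?_
  have : (fun b' : E →L[ℝ] ℝ => ‖b' - b‖) =o[𝓝 b] (fun _ => (1 : ℝ)) := by
    rw [Asymptotics.isLittleO_one_iff]
    have : Continuous fun b' : E →L[ℝ] ℝ => ‖b' - b‖ := by fun_prop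
    simpa using this.tendsto b
  have h2 := this.mul_isBigO (Asymptotics.isBigO_refl (fun b' : E →L[ℝ] ℝ => ‖b' - b‖) (𝓝 b))
  simpa using h2.norm_right.of_norm_right

end Maximizer

end AsymmetricNorm

/-! ### Natural coordinates on the cotangent bundle and their symplectic transition maps. -/

section CotangentCoordinates

lemma chart_transition_nhds {n : ℕ} {M : Type*} [TopologicalSpace M]
    {φ ψ : OpenPartialHomeomorph M (EuclideanSpace ℝ (Fin n))} {ξ : EuclideanSpace ℝ (Fin n)}
    (hξ : ξ ∈ φ.target) (hξ' : φ.symm ξ ∈ ψ.source) :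
    ∀ᶠ η in 𝓝 ξ, η ∈ φ.target ∧ φ.symm η ∈ ψ.source :=
  (φ.open_target.eventually_mem hξ).and
    ((φ.continuousAt_symm hξ).eventually (ψ.open_source.eventually_mem hξ'))

variable {n : ℕ} {M : Type*} [TopologicalSpace M] [ChartedSpace (EuclideanSpace ℝ (Fin n)) M]

section Chart

variable {φ ψ : OpenPartialHomeomorph M (EuclideanSpace ℝ (Fin n))}

lemma OpenPartialHomeomorph.mdifferentiable_of_mem_maximalAtlas
    (hφ : φ ∈ IsManifold.maximalAtlas (𝓡 n) ∞ M) : φ.MDifferentiable (𝓡 n) (𝓡 n) :=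
  ⟨fun _ hx => ((contMDiffAt_of_mem_maximalAtlas hφ hx).mdifferentiableAt
      (by simp)).mdifferentiableWithinAt,
    fun _ hx => ((contMDiffAt_symm_of_mem_maximalAtlas hφ hx).mdifferentiableAt
      (by simp)).mdifferentiableWithinAt⟩

lemma contDiffAt_chart_transition (hφ : φ ∈ IsManifold.maximalAtlas (𝓡 n) ∞ M)
    (hψ : ψ ∈ IsManifold.maximalAtlas (𝓡 n) ∞ M) {ξ : EuclideanSpace ℝ (Fin n)}
    (hξ : ξ ∈ φ.target) (hξ' : φ.symm ξ ∈ ψ.source) :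
    ContDiffAt ℝ ∞ (fun η => ψ (φ.symm η)) ξ :=
  ((contMDiffAt_of_mem_maximalAtlas hψ hξ').comp ξ
    (contMDiffAt_symm_of_mem_maximalAtlas hφ hξ)).contDiffAt

lemma mfderiv_chart_symm_apply_mfderiv (hφ : φ ∈ IsManifold.maximalAtlas (𝓡 n) ∞ M) {x : M}
    (hx : x ∈ φ.source) (v : TangentSpace (𝓡 n) x) :
    mfderiv (𝓡 n) (𝓡 n) φ.symm (φ x) (mfderiv (𝓡 n) (𝓡 n) φ x v) = v :=
  ((OpenPartialHomeomorph.mdifferentiable_of_mem_maximalAtlas hφ).mfderiv hx).symm_apply_apply v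

lemma mfderiv_chart_apply_mfderiv_symm (hφ : φ ∈ IsManifold.maximalAtlas (𝓡 n) ∞ M)
    {ξ : EuclideanSpace ℝ (Fin n)} (hξ : ξ ∈ φ.target) (v : EuclideanSpace ℝ (Fin n)) :
    mfderiv (𝓡 n) (𝓡 n) φ (φ.symm ξ) (mfderiv (𝓡 n) (𝓡 n) φ.symm ξ v) = v :=
  DFunLike.congr_fun
    ((OpenPartialHomeomorph.mdifferentiable_of_mem_maximalAtlas hφ).comp_symm_deriv hξ) v

lemma inverse_mfderiv_chart (hφ : φ ∈ IsManifold.maximalAtlas (𝓡 n) ∞ M) {x : M}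
    (hx : x ∈ φ.source) :
    (mfderiv (𝓡 n) (𝓡 n) φ x).inverse = mfderiv (𝓡 n) (𝓡 n) φ.symm (φ x) :=
  ContinuousLinearMap.inverse_equiv
    ((OpenPartialHomeomorph.mdifferentiable_of_mem_maximalAtlas hφ).mfderiv hx)

lemma fderiv_chart_transition (hφ : φ ∈ IsManifold.maximalAtlas (𝓡 n) ∞ M)
    (hψ : ψ ∈ IsManifold.maximalAtlas (𝓡 n) ∞ M) {ξ : EuclideanSpace ℝ (Fin n)}
    (hξ : ξ ∈ φ.target) (hξ' : φ.symm ξ ∈ ψ.source) (v : EuclideanSpace ℝ (Fin n)) :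
    fderiv ℝ (fun η => ψ (φ.symm η)) ξ v =
      mfderiv (𝓡 n) (𝓡 n) ψ (φ.symm ξ) (mfderiv (𝓡 n) (𝓡 n) φ.symm ξ v) := by
  rw [← mfderiv_eq_fderiv]
  exact DFunLike.congr_fun (mfderiv_comp ξ
    ((OpenPartialHomeomorph.mdifferentiable_of_mem_maximalAtlas hψ).mdifferentiableAt hξ')
    ((OpenPartialHomeomorph.mdifferentiable_of_mem_maximalAtlas hφ).mdifferentiableAt_symm hξ)) v

/-- The transition map of the cotangent bundle from the natural coordinates of `φ` to the natural
coordinates of `ψ`. -/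
def cotangentTransition (φ ψ : OpenPartialHomeomorph M (EuclideanSpace ℝ (Fin n)))
    (ζ : EuclideanSpace ℝ (Fin n) × DualModel n) : EuclideanSpace ℝ (Fin n) × DualModel n :=
  (ψ (φ.symm ζ.1), ζ.2.comp (fderiv ℝ (fun η => φ (ψ.symm η)) (ψ (φ.symm ζ.1))))

lemma cotangentTransition_self (hφ : φ ∈ IsManifold.maximalAtlas (𝓡 n) ∞ M)
    {ζ : EuclideanSpace ℝ (Fin n) × DualModel n} (hζ : ζ.1 ∈ φ.target) :
    cotangentTransition φ φ ζ = ζ := by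
  refine Prod.ext (φ.right_inv hζ) (ContinuousLinearMap.ext fun v => ?_)
  simp only [cotangentTransition]
  rw [φ.right_inv hζ, ContinuousLinearMap.comp_apply,
    fderiv_chart_transition hφ hφ hζ (φ.map_target hζ),
    mfderiv_chart_apply_mfderiv_symm hφ hζ]

variable [IsManifold (𝓡 n) ∞ M]

lemma cotangentCoord_cotangentCoordSymm_eq_transition
    (hφ : φ ∈ IsManifold.maximalAtlas (𝓡 n) ∞ M) (hψ : ψ ∈ IsManifold.maximalAtlas (𝓡 n) ∞ M)
    {ζ : EuclideanSpace ℝ (Fin n) × DualModel n} (hζ : φ.symm ζ.1 ∈ ψ.source)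
    (hζ' : ζ.1 ∈ φ.target) :
    cotangentCoord ψ (cotangentCoordSymm φ ζ) = cotangentTransition φ ψ ζ := by
  refine Prod.ext rfl (ContinuousLinearMap.ext fun v => ?_)
  have h1 := fderiv_chart_transition hψ hφ (ψ.map_source hζ)
    (by rw [ψ.left_inv hζ]; exact φ.map_target hζ') v
  rw [ψ.left_inv hζ] at h1
  simp only [cotangentTransition, cotangentCoord, cotangentCoordSymm]
  rw [ContinuousLinearMap.comp_apply, h1]
  have h2 := inverse_mfderiv_chart hψ hζ
  exact congrArg (fun L : EuclideanSpace ℝ (Fin n) →L[ℝ] EuclideanSpace ℝ (Fin n) =>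
    ζ.2 (mfderiv (𝓡 n) (𝓡 n) φ (φ.symm ζ.1) (L v))) h2

lemma cotangentCoordSymm_cotangentCoord (hφ : φ ∈ IsManifold.maximalAtlas (𝓡 n) ∞ M)
    {p : CotangentBundle (n := n) M} (hp : p.1 ∈ φ.source) :
    cotangentCoordSymm φ (cotangentCoord φ p) = p := by
  obtain ⟨x, a⟩ := p
  -- The two base points are only propositionally equal, so the base point is generalized before
  -- comparing covectors.
  have key : ∀ y, y = x → (⟨y, ContinuousLinearMap.comp (cotangentCoord φ ⟨x, a⟩).2
      (mfderiv (𝓡 n) (𝓡 n) φ y)⟩ : CotangentBundle (n := n) M) = ⟨x, a⟩ := by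
    rintro y rfl
    congr 1
    refine ContinuousLinearMap.ext fun v => ?_
    have h2 := inverse_mfderiv_chart hφ hp
    refine Eq.trans (congrArg
      (fun L : EuclideanSpace ℝ (Fin n) →L[ℝ] EuclideanSpace ℝ (Fin n) =>
        (a : EuclideanSpace ℝ (Fin n) →L[ℝ] ℝ) (L (mfderiv (𝓡 n) (𝓡 n) φ y v))) h2) ?_
    exact congrArg (a : EuclideanSpace ℝ (Fin n) →L[ℝ] ℝ)
      (mfderiv_chart_symm_apply_mfderiv hφ hp v)
  exact key _ (φ.left_inv hp)

lemma cotangentCoord_cotangentCoordSymm (hφ : φ ∈ IsManifold.maximalAtlas (𝓡 n) ∞ M)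
    {ζ : EuclideanSpace ℝ (Fin n) × DualModel n} (hζ : ζ.1 ∈ φ.target) :
    cotangentCoord φ (cotangentCoordSymm φ ζ) = ζ := by
  rw [cotangentCoord_cotangentCoordSymm_eq_transition hφ hφ (φ.map_target hζ) hζ,
    cotangentTransition_self hφ hζ]

lemma cotangentCoordSymm_cotangentTransition (hφ : φ ∈ IsManifold.maximalAtlas (𝓡 n) ∞ M)
    (hψ : ψ ∈ IsManifold.maximalAtlas (𝓡 n) ∞ M)
    {ζ : EuclideanSpace ℝ (Fin n) × DualModel n} (hζ : φ.symm ζ.1 ∈ ψ.source)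
    (hζ' : ζ.1 ∈ φ.target) :
    cotangentCoordSymm ψ (cotangentTransition φ ψ ζ) = cotangentCoordSymm φ ζ := by
  rw [← cotangentCoord_cotangentCoordSymm_eq_transition hφ hψ hζ hζ',
    cotangentCoordSymm_cotangentCoord hψ hζ]

end Chart

/-- The symplectic pairing `ω(w, (v, β)) = β(w₁) - w₂(v)` on `ℝⁿ × (ℝⁿ)*`, as a functional of
the second argument. -/
def symplecticPairing (w : EuclideanSpace ℝ (Fin n) × DualModel n) :
    EuclideanSpace ℝ (Fin n) × DualModel n →L[ℝ] ℝ :=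
  (ContinuousLinearMap.apply ℝ ℝ w.1).comp (ContinuousLinearMap.snd ℝ _ _) -
    w.2.comp (ContinuousLinearMap.fst ℝ _ _)

@[simp]
lemma symplecticPairing_apply (w z : EuclideanSpace ℝ (Fin n) × DualModel n) :
    symplecticPairing w z = z.2 w.1 - w.2 z.1 := rfl

/-- Nondegeneracy of the symplectic form; it is what recovers a Hamiltonian vector from a
differential. -/
lemma symplecticPairing_injective :
    Function.Injective (symplecticPairing (n := n)) := by
  intro w w' h
  refine Prod.ext (sub_eq_zero.1 ?_) (ContinuousLinearMap.ext fun v => ?_)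
  · refine inner_self_eq_zero (𝕜 := ℝ).1 ?_
    have := DFunLike.congr_fun h (0, innerSL ℝ (w.1 - w'.1))
    simp only [symplecticPairing_apply, map_zero, sub_zero, innerSL_apply_apply] at this
    rw [inner_sub_right, this, sub_self]
  · simpa using DFunLike.congr_fun h (v, 0)

section Transition

variable {φ ψ : OpenPartialHomeomorph M (EuclideanSpace ℝ (Fin n))}

/-- The derivative of a transition map of the cotangent bundle exists and is symplectic. -/
lemma exists_hasFDerivAt_cotangentTransition (hφ : φ ∈ IsManifold.maximalAtlas (𝓡 n) ∞ M)
    (hψ : ψ ∈ IsManifold.maximalAtlas (𝓡 n) ∞ M)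
    {ζ : EuclideanSpace ℝ (Fin n) × DualModel n} (hζ : φ.symm ζ.1 ∈ ψ.source)
    (hζ' : ζ.1 ∈ φ.target) :
    ∃ D : EuclideanSpace ℝ (Fin n) × DualModel n →L[ℝ] EuclideanSpace ℝ (Fin n) × DualModel n,
      HasFDerivAt (cotangentTransition φ ψ) D ζ ∧
      ∀ w z, symplecticPairing (D w) (D z) = symplecticPairing w z := by
  set τ : EuclideanSpace ℝ (Fin n) → EuclideanSpace ℝ (Fin n) := fun η => ψ (φ.symm η)
  set σ : EuclideanSpace ℝ (Fin n) → EuclideanSpace ℝ (Fin n) := fun η => φ (ψ.symm η)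
  have hτc : ContDiffAt ℝ ∞ τ ζ.1 := contDiffAt_chart_transition hφ hψ hζ' hζ
  have hl : ψ.symm (τ ζ.1) = φ.symm ζ.1 := ψ.left_inv hζ
  have hσc : ContDiffAt ℝ ∞ σ (τ ζ.1) :=
    contDiffAt_chart_transition hψ hφ (ψ.map_source hζ) (hl ▸ φ.map_target hζ')
  have hBc : ContDiffAt ℝ ∞ (fun η => fderiv ℝ σ (τ η)) ζ.1 :=
    (hσc.fderiv_right (m := ∞) (by simp)).comp ζ.1 hτc
  have hB := (hBc.differentiableAt (by simp)).hasFDerivAt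
  set B' := fderiv ℝ (fun η => fderiv ℝ σ (τ η)) ζ.1
  have hτd := (hτc.differentiableAt (by simp)).hasFDerivAt
  have hτ2 : HasFDerivAt (fderiv ℝ τ) (fderiv ℝ (fderiv ℝ τ) ζ.1) ζ.1 :=
    ((hτc.fderiv_right (m := ∞) (by simp)).differentiableAt (by simp)).hasFDerivAt
  -- This holds on a neighbourhood, so it can be differentiated once more; `hprod` then expresses
  -- `B'` through the second derivative of `τ`.
  have hBτ : ∀ᶠ η in 𝓝 ζ.1, (fderiv ℝ σ (τ η)).comp (fderiv ℝ τ η) =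
      ContinuousLinearMap.id ℝ _ := by
    filter_upwards [chart_transition_nhds hζ' hζ] with η hη
    have h1 := ((contDiffAt_chart_transition hψ hφ (ψ.map_source hη.2)
      (by rw [ψ.left_inv hη.2]; exact φ.map_target hη.1)).differentiableAt (by simp)).hasFDerivAt
    have h2 := ((contDiffAt_chart_transition hφ hψ hη.1 hη.2).differentiableAt
      (by simp)).hasFDerivAt
    refine (h1.comp η h2).unique ((hasFDerivAt_id η).congr_of_eventuallyEq ?_)
    filter_upwards [chart_transition_nhds hη.1 hη.2] with θ hθ
    simp [ψ.left_inv hθ.2, φ.right_inv hθ.1]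
  have hprod := (hB.clm_comp hτ2).unique
    ((hasFDerivAt_const (ContinuousLinearMap.id ℝ _) ζ.1).congr_of_eventuallyEq hBτ)
  have hsymm : IsSymmSndFDerivAt ℝ τ ζ.1 := hτc.isSymmSndFDerivAt
    (by rw [minSmoothness_of_isRCLikeNormedField]; exact WithTop.coe_le_coe.2 le_top)
  have hid : ∀ v, fderiv ℝ σ (τ ζ.1) (fderiv ℝ τ ζ.1 v) = v := fun v =>
    DFunLike.congr_fun hBτ.self_of_nhds v
  -- Symmetry of the second derivative of `τ`. It cancels the terms of the pairing that contain
  -- `ζ.2`, which is why the transition is symplectic.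
  have hanti : ∀ v v', B' v (fderiv ℝ τ ζ.1 v') = B' v' (fderiv ℝ τ ζ.1 v) := by
    have h3 : ∀ v v', B' v (fderiv ℝ τ ζ.1 v') =
        - fderiv ℝ σ (τ ζ.1) (fderiv ℝ (fderiv ℝ τ) ζ.1 v v') := fun v v' => by
      have := DFunLike.congr_fun (DFunLike.congr_fun hprod v) v'
      simp at this
      exact eq_neg_of_add_eq_zero_right this
    intro v v'
    rw [h3, h3, hsymm v v']
  have hfst : HasFDerivAt (fun ζ : EuclideanSpace ℝ (Fin n) × DualModel n => ζ.1)
    (ContinuousLinearMap.fst ℝ _ _) ζ := hasFDerivAt_fst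
  have hsnd : HasFDerivAt (fun ζ : EuclideanSpace ℝ (Fin n) × DualModel n => ζ.2)
    (ContinuousLinearMap.snd ℝ _ _) ζ := hasFDerivAt_snd
  refine ⟨_, (hτd.comp ζ hfst).prodMk (hsnd.clm_comp (hB.comp ζ hfst)), fun w z => ?_⟩
  simp only [symplecticPairing_apply, ContinuousLinearMap.prod_apply,
    ContinuousLinearMap.comp_apply, add_apply, ContinuousLinearMap.coe_fst', ContinuousLinearMap.coe_snd',
    ContinuousLinearMap.flip_apply, ContinuousLinearMap.compL_apply]
  change ζ.2 (B' z.1 (fderiv ℝ τ ζ.1 w.1)) + z.2 (fderiv ℝ σ (τ ζ.1) (fderiv ℝ τ ζ.1 w.1)) -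
    (ζ.2 (B' w.1 (fderiv ℝ τ ζ.1 z.1)) + w.2 (fderiv ℝ σ (τ ζ.1) (fderiv ℝ τ ζ.1 z.1))) = _
  rw [hid, hid, hanti z.1 w.1]
  ring

end Transition

end CotangentCoordinates

/-! ### Natural coordinates compared with the bundle charts of the cotangent bundle. -/

section CotangentComponents

variable {n : ℕ} {M : Type*} [TopologicalSpace M] [ChartedSpace (EuclideanSpace ℝ (Fin n)) M]
  [IsManifold (𝓡 n) ∞ M] {φ : OpenPartialHomeomorph M (EuclideanSpace ℝ (Fin n))}

/-- The tangent trivialization is inverted by the derivative of the inverse chart, and the trivial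
line bundle contributes the identity, so the chart of the hom bundle is precomposition with that
derivative. -/
lemma cotangentCoord_chartAt_eventuallyEq (p : CotangentBundle (n := n) M) :
    cotangentCoord (chartAt (EuclideanSpace ℝ (Fin n)) p.1) =ᶠ[𝓝 p]
      extChartAt (cotangentModel n) p := by
  have hc : IsOpen (Bundle.TotalSpace.proj ⁻¹' (chartAt (EuclideanSpace ℝ (Fin n)) p.1).source :
      Set (CotangentBundle (n := n) M)) :=
    (chartAt (EuclideanSpace ℝ (Fin n)) p.1).open_source.preimage
      (FiberBundle.continuous_proj (DualModel n)
        (fun x : M => TangentSpace (𝓡 n) x →L[ℝ] Bundle.Trivial M ℝ x))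
  filter_upwards [hc.mem_nhds (mem_chart_source _ p.1)] with q hq
  have h1 : extChartAt (cotangentModel n) p q =
    chartAt (ModelProd (EuclideanSpace ℝ (Fin n)) (DualModel n)) p q := rfl
  rw [h1, hom_chart]
  refine Prod.ext rfl (ContinuousLinearMap.ext fun v => ?_)
  have h2 := TangentBundle.symmL_trivializationAt (I := 𝓡 n) hq
  have h3 := inverse_mfderiv_chart
    (IsManifold.chart_mem_maximalAtlas (I := 𝓡 n) (n := ∞) p.1) hq
  have h4 : mfderivWithin 𝓘(ℝ, EuclideanSpace ℝ (Fin n)) (𝓡 n) (extChartAt (𝓡 n) p.1).symm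
      (Set.range (𝓡 n)) (extChartAt (𝓡 n) p.1 q.1) =
      mfderiv (𝓡 n) (𝓡 n) (chartAt (EuclideanSpace ℝ (Fin n)) p.1).symm
        (chartAt (EuclideanSpace ℝ (Fin n)) p.1 q.1) := by
    rw [ModelWithCorners.range_eq_univ, mfderivWithin_univ]
    rfl
  rw [h4] at h2
  simp only [cotangentCoord, ContinuousLinearMap.inCoordinates]
  have h5 : Bundle.Trivialization.continuousLinearMapAt ℝ
      (trivializationAt ℝ (Bundle.Trivial M ℝ) p.proj) q.proj = ContinuousLinearMap.id ℝ ℝ :=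
    Bundle.Trivial.continuousLinearMapAt_trivialization ℝ M ℝ q.proj
  refine Eq.trans (b := (q.2 : EuclideanSpace ℝ (Fin n) →L[ℝ] ℝ)
    (mfderiv (𝓡 n) (𝓡 n) (chartAt (EuclideanSpace ℝ (Fin n)) p.proj).symm
      (chartAt (EuclideanSpace ℝ (Fin n)) p.proj q.proj) v)) ?_ ?_
  · exact congrArg (fun L : EuclideanSpace ℝ (Fin n) →L[ℝ] EuclideanSpace ℝ (Fin n) =>
      (q.2 : EuclideanSpace ℝ (Fin n) →L[ℝ] ℝ) (L v)) h3
  · refine (congrArg (fun L : EuclideanSpace ℝ (Fin n) →L[ℝ] EuclideanSpace ℝ (Fin n) =>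
      (q.2 : EuclideanSpace ℝ (Fin n) →L[ℝ] ℝ) (L v)) h2).symm.trans ?_
    exact (congrArg (fun L : ℝ →L[ℝ] ℝ => L ((q.2 : EuclideanSpace ℝ (Fin n) →L[ℝ] ℝ)
      (Bundle.Trivialization.symmL ℝ (trivializationAt (EuclideanSpace ℝ (Fin n))
        (TangentSpace (𝓡 n)) p.proj) q.proj v))) h5).symm

/-- The preferred extended chart has identity derivative at its own base point, so only the
transition map contributes. This reduces components of abstract tangent vectors to calculus on `ℝⁿ ×
(ℝⁿ)*`. -/
lemma hasMFDerivAt_cotangentCoord (hφ : φ ∈ IsManifold.maximalAtlas (𝓡 n) ∞ M)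
    {p : CotangentBundle (n := n) M} (hp : p.1 ∈ φ.source)
    {D : EuclideanSpace ℝ (Fin n) × DualModel n →L[ℝ] EuclideanSpace ℝ (Fin n) × DualModel n}
    (hD : HasFDerivAt (cotangentTransition (chartAt (EuclideanSpace ℝ (Fin n)) p.1) φ) D
      (cotangentCoord (chartAt (EuclideanSpace ℝ (Fin n)) p.1) p)) :
    HasMFDerivAt (cotangentModel n) 𝓘(ℝ, EuclideanSpace ℝ (Fin n) × DualModel n)
      (cotangentCoord φ) p D := by
  have hext := cotangentCoord_chartAt_eventuallyEq p
  have hc := IsManifold.chart_mem_maximalAtlas (I := 𝓡 n) (n := ∞) p.1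
  have hopen : IsOpen (Bundle.TotalSpace.proj ⁻¹'
      ((chartAt (EuclideanSpace ℝ (Fin n)) p.1).source ∩ φ.source) :
      Set (CotangentBundle (n := n) M)) :=
    ((chartAt (EuclideanSpace ℝ (Fin n)) p.1).open_source.inter φ.open_source).preimage
      (FiberBundle.continuous_proj (DualModel n)
        (fun x : M => TangentSpace (𝓡 n) x →L[ℝ] Bundle.Trivial M ℝ x))
  have h1 : HasMFDerivAt (cotangentModel n) 𝓘(ℝ, EuclideanSpace ℝ (Fin n) × DualModel n)
      (extChartAt (cotangentModel n) p) p (ContinuousLinearMap.id ℝ _) := by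
    rw [← mfderiv_extChartAt_self]
    exact (mdifferentiableAt_extChartAt (mem_chart_source _ p)).hasMFDerivAt
  rw [hext.self_of_nhds] at hD
  have h2 := hD.hasMFDerivAt.comp p h1
  refine HasMFDerivAt.congr_of_eventuallyEq h2 ?_
  filter_upwards [hext, hopen.mem_nhds ⟨mem_chart_source _ p.1, hp⟩] with q hq hq'
  rw [Function.comp_apply, ← hq, ← cotangentCoord_cotangentCoordSymm_eq_transition hc hφ,
    cotangentCoordSymm_cotangentCoord hc hq'.1]
  · change (chartAt (EuclideanSpace ℝ (Fin n)) p.1).symm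
      (chartAt (EuclideanSpace ℝ (Fin n)) p.1 q.1) ∈ φ.source
    rw [(chartAt (EuclideanSpace ℝ (Fin n)) p.1).left_inv hq'.1]
    exact hq'.2
  · exact (chartAt (EuclideanSpace ℝ (Fin n)) p.1).map_source hq'.1

end CotangentComponents

/-! ### Local sections of the projection, and linear frames adapted to an invariant `F`. -/

section LocalFrame

lemma Filter.EventuallyEq.tangentMap_eq {k l : ℕ} {M N : Type*}
    [TopologicalSpace M] [ChartedSpace (EuclideanSpace ℝ (Fin k)) M]
    [TopologicalSpace N] [ChartedSpace (EuclideanSpace ℝ (Fin l)) N] {f g : M → N}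
    {v : TangentBundle (𝓡 k) M} (h : f =ᶠ[𝓝 v.1] g) :
    tangentMap (𝓡 k) (𝓡 l) f v = tangentMap (𝓡 k) (𝓡 l) g v :=
  Bundle.TotalSpace.ext h.self_of_nhds (heq_of_eq (DFunLike.congr_fun h.mfderiv_eq v.2))

/-- A submersion has smooth local sections. -/
lemma Manifold.IsSubmersionAt.exists_section {m n : ℕ} {M N : Type*}
    [TopologicalSpace M] [ChartedSpace (EuclideanSpace ℝ (Fin m)) M]
    [TopologicalSpace N] [ChartedSpace (EuclideanSpace ℝ (Fin n)) N] {f : M → N} {x : M}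
    (h : Manifold.IsSubmersionAt (𝓡 m) (𝓡 n) ∞ f x) :
    ∃ s : N → M, ContMDiffAt (𝓡 n) (𝓡 m) ∞ s (f x) ∧ ∀ᶠ y in 𝓝 (f x), f (s y) = y := by
  obtain ⟨C, _, _, d, c, hd, hc, hdm, hcm, hsub, e, he⟩ := h
  have hcoord : ∀ ξ ∈ d.target, c (f (d.symm ξ)) = (e ξ).1 := fun ξ hξ => he (by simpa using hξ)
  set b : C := (e (d x)).2
  -- In the submersion charts `f` is the projection to the first factor; the section freezes the
  -- complementary coordinate at its value `b` at `x`.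
  set q : N → EuclideanSpace ℝ (Fin m) := fun y => e.symm (c y, b) with hq
  have hqx : q (f x) = d x := by
    have := hcoord (d x) (d.map_source hd)
    rw [d.left_inv hd] at this
    simp only [hq, this]
    exact e.symm_apply_apply (d x)
  have hqs : ContMDiffAt (𝓡 n) (𝓡 m) ∞ q (f x) := by
    have h1 : ContDiff ℝ ∞ (fun η : EuclideanSpace ℝ (Fin n) => e.symm (η, b)) := by fun_prop
    exact h1.contMDiff.contMDiffAt.comp (f x) (contMDiffAt_of_mem_maximalAtlas hcm hc)
  refine ⟨fun y => d.symm (q y), (contMDiffAt_symm_of_mem_maximalAtlas hdm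
    (d.map_source hd)).comp_of_eq hqs hqx, ?_⟩
  have h2 : ∀ᶠ y in 𝓝 (f x), q y ∈ d.target :=
    hqs.continuousAt.eventually (by rw [hqx]; exact d.open_target.mem_nhds (d.map_source hd))
  filter_upwards [h2, c.open_source.mem_nhds hc] with y hy hy'
  refine c.injOn (hsub (d.map_target hy)) hy' ?_
  rw [hcoord _ hy, hq, e.apply_symm_apply]

section Coord

variable {n : ℕ} {M : Type*} [TopologicalSpace M] [ChartedSpace (EuclideanSpace ℝ (Fin n)) M]

/-- The function `F` on `TM` in the natural coordinates of the tangent bundle given by `φ`. -/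
def coordFinsler (F : TangentBundle (𝓡 n) M → ℝ)
    (φ : OpenPartialHomeomorph M (EuclideanSpace ℝ (Fin n)))
    (ξ y : EuclideanSpace ℝ (Fin n)) : ℝ :=
  F (tangentMap (𝓡 n) (𝓡 n) φ.symm ⟨ξ, y⟩)

/-- Near `p` there is, in the coordinates `φ`, a `C²` family of linear maps `A ξ` which pulls the
functions `F(x, ·)` back to `F(p, ·)`. -/
def HasLocalFrameAt (F : TangentBundle (𝓡 n) M → ℝ)
    (φ : OpenPartialHomeomorph M (EuclideanSpace ℝ (Fin n))) (p : M) : Prop :=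
  ∃ (A : EuclideanSpace ℝ (Fin n) → EuclideanSpace ℝ (Fin n) →L[ℝ] EuclideanSpace ℝ (Fin n))
    (U : Set (EuclideanSpace ℝ (Fin n))), IsOpen U ∧ φ p ∈ U ∧ U ⊆ φ.target ∧
      ContDiffOn ℝ 2 A U ∧ ∀ ξ ∈ U, ∀ y, coordFinsler F φ ξ (A ξ y) = coordFinsler F φ (φ p) y

end Coord

variable {m n : ℕ} {G : Type*} [Group G] [TopologicalSpace G]
    [ChartedSpace (EuclideanSpace ℝ (Fin m)) G] [LieGroup (𝓡 m) ∞ G]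
    {H : Subgroup G} [ChartedSpace (EuclideanSpace ℝ (Fin n)) (G ⧸ H)]

/-- Near a coset, the action of `g` is the projection of `g * s x` for a smooth local section `s`,
hence a composition of smooth maps. -/
lemma contMDiff_smul_quotient
    (hπ : Manifold.IsSubmersion (𝓡 m) (𝓡 n) ∞ (QuotientGroup.mk : G → G ⧸ H)) (g : G) :
    ContMDiff (𝓡 n) (𝓡 n) ∞ (fun x : G ⧸ H => g • x) := by
  intro x
  obtain ⟨a, rfl⟩ := QuotientGroup.mk_surjective x
  obtain ⟨s, hs, hs'⟩ := (hπ.isSubmersionAt a).exists_section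
  have h1 : ContMDiffAt (𝓡 n) (𝓡 n) ∞ (fun x : G ⧸ H => (QuotientGroup.mk (g * s x) : G ⧸ H))
      (QuotientGroup.mk a) :=
    hπ.contMDiff.contMDiffAt.comp _ (contMDiffAt_const.mul hs)
  refine h1.congr_of_eventuallyEq ?_
  filter_upwards [hs'] with y hy
  conv_lhs => rw [← hy]
  rfl

/-- An invariant function on the tangent bundle of `G ⧸ H` has local frames. -/
lemma hasLocalFrameAt_of_invariant
    (hπ : Manifold.IsSubmersion (𝓡 m) (𝓡 n) ∞ (QuotientGroup.mk : G → G ⧸ H))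
    {F : TangentBundle (𝓡 n) (G ⧸ H) → ℝ}
    (hinv : ∀ (g : G) (v : TangentBundle (𝓡 n) (G ⧸ H)),
      F (tangentMap (𝓡 n) (𝓡 n) (fun x : G ⧸ H => g • x) v) = F v)
    {φ : OpenPartialHomeomorph (G ⧸ H) (EuclideanSpace ℝ (Fin n))}
    (hφ : φ ∈ IsManifold.maximalAtlas (𝓡 n) ∞ (G ⧸ H)) {p : G ⧸ H} (hp : p ∈ φ.source) :
    HasLocalFrameAt F φ p := by
  obtain ⟨a, ha⟩ := QuotientGroup.mk_surjective p
  obtain ⟨s, hs, hs'⟩ := (hπ.isSubmersionAt a).exists_section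
  rw [ha] at hs hs'
  set ξ₀ := φ p
  have hξ₀ : ξ₀ ∈ φ.target := φ.map_source hp
  have hp₀ : φ.symm ξ₀ = p := φ.left_inv hp
  set S : EuclideanSpace ℝ (Fin n) → G := fun ξ => s (φ.symm ξ)
  have hS : ContMDiffAt (𝓡 n) (𝓡 m) ∞ S ξ₀ :=
    hs.comp_of_eq (contMDiffAt_symm_of_mem_maximalAtlas hφ hξ₀) hp₀
  have hS' : ∀ᶠ ξ in 𝓝 ξ₀, (QuotientGroup.mk (S ξ) : G ⧸ H) = φ.symm ξ := by
    have := φ.continuousAt_symm hξ₀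
    rw [ContinuousAt, hp₀] at this
    exact this.eventually hs'
  -- In coordinates, `Φ ξ` is translation by `S ξ * (S ξ₀)⁻¹`, which moves `p` to the point with
  -- coordinates `ξ`. Lifting `η` by `S` as well exhibits joint smoothness through multiplication in
  -- `G`. The frame is its derivative in `η` at `ξ₀`.
  set Φ : EuclideanSpace ℝ (Fin n) → EuclideanSpace ℝ (Fin n) → EuclideanSpace ℝ (Fin n) :=
    fun ξ η => φ (QuotientGroup.mk (S ξ * (S ξ₀)⁻¹ * S η))
  have hΦ : ContDiffAt ℝ ∞ (Function.uncurry Φ) (ξ₀, ξ₀) := by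
    rw [← contMDiffAt_iff_contDiffAt]
    have hfst : ContMDiffAt 𝓘(ℝ, EuclideanSpace ℝ (Fin n) × EuclideanSpace ℝ (Fin n)) (𝓡 m) ∞
        (fun z : EuclideanSpace ℝ (Fin n) × EuclideanSpace ℝ (Fin n) => S z.1) (ξ₀, ξ₀) :=
      ContMDiffAt.comp (ξ₀, ξ₀) (I' := 𝓡 n) (g := S) hS contDiff_fst.contMDiff.contMDiffAt
    have hsnd : ContMDiffAt 𝓘(ℝ, EuclideanSpace ℝ (Fin n) × EuclideanSpace ℝ (Fin n)) (𝓡 m) ∞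
        (fun z : EuclideanSpace ℝ (Fin n) × EuclideanSpace ℝ (Fin n) => S z.2) (ξ₀, ξ₀) :=
      ContMDiffAt.comp (ξ₀, ξ₀) (I' := 𝓡 n) (g := S) hS contDiff_snd.contMDiff.contMDiffAt
    have hprod := (hfst.mul contMDiffAt_const).mul (f := fun z => S z.1 * (S ξ₀)⁻¹) hsnd
    refine ContMDiffAt.comp_of_eq (contMDiffAt_of_mem_maximalAtlas hφ hp)
      (hπ.contMDiff.contMDiffAt.comp (ξ₀, ξ₀) hprod) ?_
    change (QuotientGroup.mk (S ξ₀ * (S ξ₀)⁻¹ * S ξ₀) : G ⧸ H) = p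
    rw [mul_inv_cancel, one_mul, hS'.self_of_nhds, hp₀]
  have hA : ContDiffAt ℝ ∞ (fun ξ => fderiv ℝ (Φ ξ) ξ₀) ξ₀ :=
    ContDiffAt.fderiv (g := fun _ => ξ₀) hΦ contDiffAt_const (by simp)
  obtain ⟨U₁, hU₁, hAU₁⟩ := hA.contDiffOn (m := 2) (WithTop.coe_le_coe.2 le_top) (by simp)
  obtain ⟨U, hUsub, hUo, hU⟩ := mem_nhds_iff.1
    (Filter.inter_mem hU₁ (Filter.inter_mem (φ.open_target.mem_nhds hξ₀) hS'))
  refine ⟨fun ξ => fderiv ℝ (Φ ξ) ξ₀, U, hUo, hU, fun ξ hξ => (hUsub hξ).2.1,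
    hAU₁.mono fun ξ hξ => (hUsub hξ).1, fun ξ hξ y => ?_⟩
  have hξt : ξ ∈ φ.target := (hUsub hξ).2.1
  have hξS : (QuotientGroup.mk (S ξ) : G ⧸ H) = φ.symm ξ := (hUsub hξ).2.2
  set g := S ξ * (S ξ₀)⁻¹ with hg
  have hgp : g • p = φ.symm ξ := by
    rw [← hξS, ← hp₀, ← hS'.self_of_nhds]
    change (QuotientGroup.mk (g * S ξ₀) : G ⧸ H) = _
    rw [hg, inv_mul_cancel_right]
  have hact := contMDiff_smul_quotient hπ g
  have hΦξ : Φ ξ =ᶠ[𝓝 ξ₀] fun η => φ (g • φ.symm η) := by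
    filter_upwards [hS'] with η hη
    rw [← hη]
    rfl
  have hφsymm : MDifferentiableAt (𝓡 n) (𝓡 n) φ.symm ξ₀ :=
    (contMDiffAt_symm_of_mem_maximalAtlas hφ hξ₀).mdifferentiableAt (by simp)
  have hgφ : ContMDiffAt (𝓡 n) (𝓡 n) ∞ (fun η => g • φ.symm η) ξ₀ :=
    hact.contMDiffAt.comp ξ₀ (contMDiffAt_symm_of_mem_maximalAtlas hφ hξ₀)
  have hgp' : g • φ.symm ξ₀ = φ.symm ξ := by rw [hp₀, hgp]
  have hgps : φ.symm ξ ∈ φ.source := φ.map_target hξt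
  have hΦd : MDifferentiableAt (𝓡 n) (𝓡 n) (Φ ξ) ξ₀ :=
    ((contMDiffAt_of_mem_maximalAtlas hφ hgps).comp_of_eq hgφ hgp').congr_of_eventuallyEq
      hΦξ |>.mdifferentiableAt (by simp)
  have hΦ₀ : Φ ξ ξ₀ = ξ := by
    refine hΦξ.self_of_nhds.trans ?_
    simp only [hgp', φ.right_inv hξt]
  have h1 : tangentMap (𝓡 n) (𝓡 n) (Φ ξ) ⟨ξ₀, y⟩ =
      (⟨ξ, fderiv ℝ (Φ ξ) ξ₀ y⟩ : TangentBundle (𝓡 n) (EuclideanSpace ℝ (Fin n))) :=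
    Bundle.TotalSpace.ext hΦ₀ (heq_of_eq (by rw [← mfderiv_eq_fderiv]; rfl))
  -- The chart intertwines `Φ ξ` with the action of `g`, so the chain rule turns invariance of `F`
  -- into the frame identity.
  have h2 : φ.symm ∘ Φ ξ =ᶠ[𝓝 ξ₀] (fun x : G ⧸ H => g • x) ∘ φ.symm := by
    have : ∀ᶠ η in 𝓝 ξ₀, g • φ.symm η ∈ φ.source :=
      hgφ.continuousAt.eventually (hgp'.symm ▸ φ.open_source.mem_nhds hgps :)
    filter_upwards [hΦξ, this] with η h3 h4
    rw [Function.comp_apply, Function.comp_apply, h3, φ.left_inv h4]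
  unfold coordFinsler
  rw [← h1, ← tangentMap_comp_at _ (by
      change MDifferentiableAt (𝓡 n) (𝓡 n) φ.symm (Φ ξ ξ₀)
      rw [hΦ₀]
      exact (contMDiffAt_symm_of_mem_maximalAtlas hφ hξt).mdifferentiableAt (by simp)) hΦd,
    Filter.EventuallyEq.tangentMap_eq h2,
    tangentMap_comp_at _ (hact.mdifferentiable (by simp) _) hφsymm, hinv]

/-- The restriction of an invariant Finsler structure to every tangent space is strongly convex as
soon as one of them is. -/
lemma isStronglyConvexAsymmetricNorm_of_invariant
    (hπ : Manifold.IsSubmersion (𝓡 m) (𝓡 n) ∞ (QuotientGroup.mk : G → G ⧸ H))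
    {F : TangentBundle (𝓡 n) (G ⧸ H) → ℝ}
    (hinv : ∀ (g : G) (v : TangentBundle (𝓡 n) (G ⧸ H)),
      F (tangentMap (𝓡 n) (𝓡 n) (fun x : G ⧸ H => g • x) v) = F v) {x : G ⧸ H}
    (hx : IsStronglyConvexAsymmetricNorm (fun y : TangentSpace (𝓡 n) x => F ⟨x, y⟩)) (p : G ⧸ H) :
    IsStronglyConvexAsymmetricNorm (fun y : TangentSpace (𝓡 n) p => F ⟨p, y⟩) := by
  obtain ⟨g, rfl⟩ := MulAction.exists_smul_eq G p x
  set D := mfderiv (𝓡 n) (𝓡 n) (fun x : G ⧸ H => g • x) p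
  have hD : ∀ y : TangentSpace (𝓡 n) p, F ⟨g • p, D y⟩ = F ⟨p, y⟩ := fun y => hinv g ⟨p, y⟩
  have hcomp : ∀ y : TangentSpace (𝓡 n) p,
      mfderiv (𝓡 n) (𝓡 n) (fun x : G ⧸ H => g⁻¹ • x) (g • p) (D y) = y := by
    have h1 := mfderiv_comp p ((contMDiff_smul_quotient hπ g⁻¹).mdifferentiable (by simp) (g • p))
      ((contMDiff_smul_quotient hπ g).mdifferentiable (by simp) p)
    have h2 : (fun x : G ⧸ H => g⁻¹ • x) ∘ (fun x : G ⧸ H => g • x) = id := by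
      funext y; simp
    rw [h2, mfderiv_id] at h1
    exact fun y => (DFunLike.congr_fun h1 y).symm
  have hinj : Function.Injective D := Function.LeftInverse.injective hcomp
  -- Both tangent spaces are `ℝⁿ` by definition; read as an endomorphism, `D` is surjective because
  -- it is injective.
  let D' : EuclideanSpace ℝ (Fin n) →L[ℝ] EuclideanSpace ℝ (Fin n) := D
  have hsurj : Function.Surjective D := LinearMap.surjective_of_injective (f := D'.toLinearMap) hinj
  have h := hx.comp_linearEquiv (LinearEquiv.ofBijective D.toLinearMap ⟨hinj, hsurj⟩)
  exact (funext hD : (fun y : TangentSpace (𝓡 n) p => F ⟨g • p, D y⟩) = _) ▸ h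

end LocalFrame

/-! ### Admissible families built from local frames. -/

section PontryaginType

variable {n : ℕ} {M : Type*} [TopologicalSpace M] [ChartedSpace (EuclideanSpace ℝ (Fin n)) M]
  {F : TangentBundle (𝓡 n) M → ℝ} {φ : OpenPartialHomeomorph M (EuclideanSpace ℝ (Fin n))}

/-- The linear equivalence between `ℝⁿ` and the tangent space given by a chart. -/
def chartTangentEquiv (hφ : φ ∈ IsManifold.maximalAtlas (𝓡 n) ∞ M)
    {ξ : EuclideanSpace ℝ (Fin n)} (hξ : ξ ∈ φ.target) :
    EuclideanSpace ℝ (Fin n) ≃ₗ[ℝ] TangentSpace (𝓡 n) (φ.symm ξ) :=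
  ((OpenPartialHomeomorph.mdifferentiable_of_mem_maximalAtlas hφ).symm.mfderiv hξ).toLinearEquiv

lemma IsAsymmetricNorm.coordFinsler (hφ : φ ∈ IsManifold.maximalAtlas (𝓡 n) ∞ M)
    {ξ : EuclideanSpace ℝ (Fin n)} (hξ : ξ ∈ φ.target)
    (hF : IsAsymmetricNorm (fun y : TangentSpace (𝓡 n) (φ.symm ξ) => F ⟨φ.symm ξ, y⟩)) :
    IsAsymmetricNorm (coordFinsler F φ ξ) :=
  hF.comp_linearEquiv (chartTangentEquiv hφ hξ)

lemma IsStronglyConvexAsymmetricNorm.coordFinsler (hφ : φ ∈ IsManifold.maximalAtlas (𝓡 n) ∞ M)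
    {ξ : EuclideanSpace ℝ (Fin n)} (hξ : ξ ∈ φ.target)
    (hF : IsStronglyConvexAsymmetricNorm
      (fun y : TangentSpace (𝓡 n) (φ.symm ξ) => F ⟨φ.symm ξ, y⟩)) :
    IsStronglyConvexAsymmetricNorm (coordFinsler F φ ξ) :=
  hF.comp_linearEquiv (chartTangentEquiv hφ hξ)

/-- Definiteness of `N` kills the kernel, and finite dimension does the rest. This is why frames
need no separate invertibility assumption. -/
lemma IsAsymmetricNorm.bijective_of_comp_eq {E : Type*} [NormedAddCommGroup E] [NormedSpace ℝ E]
    [FiniteDimensional ℝ E] {N N' : E → ℝ} (hN : IsAsymmetricNorm N) (hN' : IsAsymmetricNorm N')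
    {L : E →L[ℝ] E} (h : ∀ y, N' (L y) = N y) : Function.Bijective L := by
  have hinj : Function.Injective L := by
    rw [injective_iff_map_eq_zero]
    intro y hy
    rw [← hN.eq_zero_iff, ← h, hy, hN'.map_zero]
  exact ⟨hinj, LinearMap.surjective_of_injective (f := L.toLinearMap) hinj⟩

lemma apply_eq_coordFinsler_mfderiv (hφ : φ ∈ IsManifold.maximalAtlas (𝓡 n) ∞ M) {x : M}
    (hx : x ∈ φ.source) (v : TangentSpace (𝓡 n) x) :
    F ⟨x, v⟩ = coordFinsler F φ (φ x) (mfderiv (𝓡 n) (𝓡 n) φ x v) :=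
  congrArg F (Bundle.TotalSpace.ext (φ.left_inv hx).symm
    (heq_of_eq (mfderiv_chart_symm_apply_mfderiv hφ hx v).symm))

lemma apply_mfderiv_symm_eq_coordFinsler {x : M}
    (hx : x ∈ φ.source) (v : EuclideanSpace ℝ (Fin n)) :
    F ⟨x, (mfderiv (𝓡 n) (𝓡 n) φ.symm (φ x) v : EuclideanSpace ℝ (Fin n))⟩ =
      coordFinsler F φ (φ x) v :=
  congrArg F (Bundle.TotalSpace.ext (φ.left_inv hx).symm (heq_of_eq rfl))

/-- A Finsler structure with local frames is of Pontryagin type. -/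
lemma isPontryaginTypeAt_of_hasLocalFrameAt [IsManifold (𝓡 n) ∞ M] (hF : IsC0Finsler F)
    (hφ : φ ∈ IsManifold.maximalAtlas (𝓡 n) ∞ M) {p : M} (hp : p ∈ φ.source)
    (hframe : HasLocalFrameAt F φ p) : IsPontryaginTypeAt F p := by
  obtain ⟨A, U, hUo, hpU, hUt, hA, hAF⟩ := hframe
  have hN : ∀ ξ ∈ φ.target, IsAsymmetricNorm (coordFinsler F φ ξ) := fun ξ hξ =>
    (hF.asymmetricNorm _).coordFinsler hφ hξ
  set N := coordFinsler F φ (φ p)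
  have hN₀ : IsAsymmetricNorm N := hN _ (φ.map_source hp)
  -- Radial projection of the Euclidean sphere onto the unit sphere of the reference norm `N`.
  let Y : Metric.sphere (0 : EuclideanSpace ℝ (Fin n)) 1 → EuclideanSpace ℝ (Fin n) :=
    fun u => (N u)⁻¹ • (u : EuclideanSpace ℝ (Fin n))
  have hu0 : ∀ u : Metric.sphere (0 : EuclideanSpace ℝ (Fin n)) 1,
      (u : EuclideanSpace ℝ (Fin n)) ≠ 0 := ne_zero_of_mem_unit_sphere
  have hY : Continuous Y :=
    ((hN₀.continuous.comp continuous_subtype_val).inv₀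
      fun u => (hN₀.pos (hu0 u)).ne').smul continuous_subtype_val
  have hYinj : Function.Injective Y := by
    intro u v huv
    have h1 := congrArg (‖·‖) huv
    simp only [Y, norm_smul, norm_inv, norm_eq_of_mem_sphere, mul_one, inv_inj,
      Real.norm_of_nonneg (hN₀.nonneg _)] at h1
    simp only [Y, h1] at huv
    exact Subtype.ext (smul_right_injective _ (inv_ne_zero (hN₀.pos (hu0 v)).ne') huv)
  have hYrange : ∀ y, N y = 1 → ∃ u, Y u = y := by
    intro y hy
    have hy0 := hN₀.ne_zero_of_eq_one hy
    refine ⟨⟨‖y‖⁻¹ • y, by simp [norm_smul, hy0]⟩, ?_⟩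
    simp only [Y]
    rw [hN₀.smul_of_nonneg (by positivity), hy, mul_one, inv_inv, smul_smul,
      mul_inv_cancel₀ (norm_ne_zero_iff.2 hy0), one_smul]
  have hAbij : ∀ ξ ∈ U, Function.Bijective (A ξ) := fun ξ hξ =>
    hN₀.bijective_of_comp_eq (hN ξ (hUt hξ)) (hAF ξ hξ)
  -- The frame transports the reference sphere at `p` to the unit sphere at `x`.
  let X : Metric.sphere (0 : EuclideanSpace ℝ (Fin n)) 1 → (x : M) → TangentSpace (𝓡 n) x :=
    fun u x => (mfderiv (𝓡 n) (𝓡 n) φ.symm (φ x) (A (φ x) (Y u)) : EuclideanSpace ℝ (Fin n))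
  have hs : IsOpen (φ.source ∩ φ ⁻¹' U) := φ.isOpen_inter_preimage hUo
  set χ := φ.restr (φ.source ∩ φ ⁻¹' U) with hχ
  have hsource : ∀ x ∈ χ.source, x ∈ φ.source ∧ φ x ∈ U := by
    intro x hx
    rw [hχ, OpenPartialHomeomorph.restr_source, hs.interior_eq] at hx
    exact hx.2
  have htarget : ∀ ξ ∈ χ.target, ξ ∈ φ.target ∧ ξ ∈ U := by
    intro ξ hξ
    have h1 := hsource _ (χ.map_target hξ)
    have h2 : ξ ∈ φ.target := hξ.1
    refine ⟨h2, ?_⟩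
    have h3 : φ (φ.symm ξ) ∈ U := h1.2
    rwa [φ.right_inv h2] at h3
  have hfield : ∀ u, ∀ ξ ∈ χ.target, fieldInChart χ (X u) ξ = A ξ (Y u) := by
    intro u ξ hξ
    have h2 := (htarget ξ hξ).1
    refine Eq.trans ?_ (mfderiv_chart_apply_mfderiv_symm hφ h2 (A ξ (Y u)))
    change mfderiv (𝓡 n) (𝓡 n) φ (φ.symm ξ) (mfderiv (𝓡 n) (𝓡 n) φ.symm (φ (φ.symm ξ))
      (A (φ (φ.symm ξ)) (Y u)) : EuclideanSpace ℝ (Fin n)) = _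
    rw [φ.right_inv h2]
  have hcd : ∀ ξ ∈ χ.target, ContDiffAt ℝ 2 A ξ := fun ξ hξ =>
    hA.contDiffAt (hUo.mem_nhds (htarget ξ hξ).2)
  refine ⟨χ, restr_mem_maximalAtlas _ hφ hs, ?_, X, ?_, ?_, ?_, ?_, ?_⟩
  · rw [hχ, OpenPartialHomeomorph.restr_source, hs.interior_eq]
    exact ⟨hp, hp, hpU⟩
  · intro u
    refine ContDiffOn.congr (fun ξ hξ => ?_) (hfield u)
    exact (((hcd ξ hξ).of_le one_le_two).clm_apply contDiffAt_const).contDiffWithinAt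
  · intro x hx
    obtain ⟨h1, h2⟩ := hsource x hx
    let L : EuclideanSpace ℝ (Fin n) →L[ℝ] EuclideanSpace ℝ (Fin n) :=
      mfderiv (𝓡 n) (𝓡 n) φ.symm (φ x)
    have hL : Function.Injective L := (chartTangentEquiv hφ (φ.map_source h1)).injective
    have hcont : Continuous fun u => L (A (φ x) (Y u)) :=
      L.continuous.comp ((A (φ x)).continuous.comp hY)
    -- A continuous injection from the compact sphere into a Hausdorff space is an embedding.
    exact (hcont.isClosedEmbedding (hL.comp ((hAbij _ h2).1.comp hYinj))).isEmbedding
  · intro x hx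
    obtain ⟨h1, h2⟩ := hsource x hx
    refine Set.Subset.antisymm ?_ fun y hy => ?_
    · rintro _ ⟨u, rfl⟩
      refine (apply_mfderiv_symm_eq_coordFinsler h1 _).trans ?_
      rw [hAF _ h2]
      exact hN₀.map_inv_smul_self (hu0 u)
    · obtain ⟨z, hz⟩ := (hAbij _ h2).2 (mfderiv (𝓡 n) (𝓡 n) φ x y)
      have hy1 : F ⟨x, y⟩ = 1 := hy
      rw [apply_eq_coordFinsler_mfderiv (F := F) hφ h1 y] at hy1
      have hNz : N z = 1 := by
        rw [← hAF _ h2, hz]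
        exact hy1
      obtain ⟨u, rfl⟩ := hYrange z hNz
      refine ⟨u, ?_⟩
      refine Eq.trans ?_ (mfderiv_chart_symm_apply_mfderiv hφ h1 y)
      change mfderiv (𝓡 n) (𝓡 n) φ.symm (φ x) (A (φ x) (Y u)) = _
      rw [hz]
  · have : ContinuousOn (fun q : EuclideanSpace ℝ (Fin n) ×
        Metric.sphere (0 : EuclideanSpace ℝ (Fin n)) 1 => A q.1 (Y q.2)) (χ.target ×ˢ Set.univ) :=
      fun q hq => (((hcd q.1 hq.1).continuousAt.comp continuousAt_fst).clm_apply
        (hY.continuousAt.comp continuousAt_snd)).continuousWithinAt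
    exact this.congr fun q hq => hfield q.2 q.1 hq.1
  · have : ContinuousOn (fun q : EuclideanSpace ℝ (Fin n) ×
        Metric.sphere (0 : EuclideanSpace ℝ (Fin n)) 1 => (fderiv ℝ A q.1).flip (Y q.2))
        (χ.target ×ˢ Set.univ) := by
      intro q hq
      have h1 : ContinuousAt (fun ξ => (fderiv ℝ A ξ).flip) q.1 :=
        (ContinuousLinearMap.flipₗᵢ ℝ _ _ _).continuous.continuousAt.comp
          ((hcd q.1 hq.1).fderiv_right (m := 1) (by norm_num)).continuousAt
      exact ((h1.comp continuousAt_fst).clm_apply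
        (hY.continuousAt.comp continuousAt_snd)).continuousWithinAt
    refine this.congr fun q hq => ?_
    have h1 : fieldInChart χ (X q.2) =ᶠ[𝓝 q.1] fun ξ => A ξ (Y q.2) := by
      filter_upwards [χ.open_target.mem_nhds hq.1] with ξ hξ using hfield _ ξ hξ
    have h2 := ((hcd q.1 hq.1).differentiableAt (by simp)).hasFDerivAt.clm_apply
      (hasFDerivAt_const (Y q.2) q.1)
    change fderiv ℝ (fieldInChart χ (X q.2)) q.1 = _
    rw [h1.fderiv_eq, h2.fderiv]
    simp

end PontryaginType

/-! ### Maps that are Lipschitz near a point. -/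

section LipschitzNear

/-- `f` is Lipschitz on a neighbourhood of `x`. -/
def IsLipschitzNear {X Y : Type*} [PseudoMetricSpace X] [PseudoMetricSpace Y] (f : X → Y) (x : X) :
    Prop :=
  ∃ K, ∃ t ∈ 𝓝 x, LipschitzOnWith K f t

lemma IsLipschitzNear.comp {X Y Z : Type*} [PseudoMetricSpace X] [PseudoMetricSpace Y]
    [PseudoMetricSpace Z] {g : Y → Z} {f : X → Y} {x : X} (hg : IsLipschitzNear g (f x))
    (hf : IsLipschitzNear f x) : IsLipschitzNear (g ∘ f) x := by
  obtain ⟨K, t, ht, hK⟩ := hg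
  obtain ⟨L, s, hs, hL⟩ := hf
  exact ⟨K * L, s ∩ f ⁻¹' t, Filter.inter_mem hs (hL.continuousOn.continuousAt hs ht),
    hK.comp (hL.mono Set.inter_subset_left) fun _ h => h.2⟩

lemma IsLipschitzNear.prodMk {X Y Z : Type*} [PseudoMetricSpace X] [PseudoMetricSpace Y]
    [PseudoMetricSpace Z] {g : X → Z} {f : X → Y} {x : X} (hf : IsLipschitzNear f x)
    (hg : IsLipschitzNear g x) : IsLipschitzNear (fun x => (f x, g x)) x := by
  obtain ⟨K, t, ht, hK⟩ := hf
  obtain ⟨L, s, hs, hL⟩ := hg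
  exact ⟨max K L, t ∩ s, Filter.inter_mem ht hs,
    (hK.mono Set.inter_subset_left).prodMk (hL.mono Set.inter_subset_right)⟩

lemma ContDiffAt.isLipschitzNear {E F : Type*} [NormedAddCommGroup E] [NormedSpace ℝ E]
    [NormedAddCommGroup F] [NormedSpace ℝ F] {f : E → F} {x : E} (hf : ContDiffAt ℝ 1 f x) :
    IsLipschitzNear f x :=
  hf.exists_lipschitzOnWith

lemma contDiff_flip {E : Type*} [NormedAddCommGroup E] [NormedSpace ℝ E] :
    ContDiff ℝ 1 (fun L : E →L[ℝ] E →L[ℝ] E => L.flip) :=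
  IsBoundedLinearMap.contDiff ⟨⟨fun _ _ => rfl, fun _ _ => rfl⟩, 1, one_pos, fun L => by
    rw [one_mul]; exact L.opNorm_flip.le⟩

end LipschitzNear

/-! ### Calculus of the Hamiltonian `N (α ∘ A ξ)`. -/

section LinearFrame

variable {E : Type*} [NormedAddCommGroup E] [NormedSpace ℝ E] {A : E → E →L[ℝ] E}

/-- The covector component contains the derivative of `A`, so `A` must be `C²`. The maximizer is
kept as an independent variable because it will be only Lipschitz in `ζ`. -/
lemma contDiffAt_hamiltonianField {ζ : E × (E →L[ℝ] ℝ)} {y : E} (hA : ContDiffAt ℝ 2 A ζ.1) :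
    ContDiffAt ℝ 1 (fun q : (E × (E →L[ℝ] ℝ)) × E => (A q.1.1 q.2,
      -(q.1.2.comp ((fderiv ℝ A q.1.1).flip q.2)))) (ζ, y) := by
  have hfst : ContDiffAt ℝ 1 (fun q : (E × (E →L[ℝ] ℝ)) × E => q.1.1) (ζ, y) := contDiffAt_fst.fst
  have hsnd : ContDiffAt ℝ 1 (fun q : (E × (E →L[ℝ] ℝ)) × E => q.1.2) (ζ, y) := contDiffAt_fst.snd
  have h1 : ContDiffAt ℝ 1 (fun q : (E × (E →L[ℝ] ℝ)) × E => A q.1.1 q.2) (ζ, y) :=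
    ((hA.of_le one_le_two).comp (ζ, y) hfst).clm_apply contDiffAt_snd
  have hflip : ContDiffAt ℝ 1 (fun ξ => (fderiv ℝ A ξ).flip) ζ.1 :=
    contDiff_flip.contDiffAt.comp _ (hA.fderiv_right (m := 1) (by norm_num))
  have h2 : ContDiffAt ℝ 1 (fun q : (E × (E →L[ℝ] ℝ)) × E => (fderiv ℝ A q.1.1).flip) (ζ, y) :=
    ContDiffAt.comp (g := fun ξ => (fderiv ℝ A ξ).flip) (ζ, y) hflip hfst
  exact h1.prodMk (hsnd.clm_comp (h2.clm_apply contDiffAt_snd)).neg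

lemma isLipschitzNear_hamiltonianField {Y : (E →L[ℝ] ℝ) → E} {ζ : E × (E →L[ℝ] ℝ)}
    (hA : ContDiffAt ℝ 2 A ζ.1) (hY : IsLipschitzNear Y (ζ.2.comp (A ζ.1))) :
    IsLipschitzNear (fun ζ : E × (E →L[ℝ] ℝ) => (A ζ.1 (Y (ζ.2.comp (A ζ.1))),
      -(ζ.2.comp ((fderiv ℝ A ζ.1).flip (Y (ζ.2.comp (A ζ.1))))))) ζ := by
  have hb : ContDiffAt ℝ 1 (fun ζ : E × (E →L[ℝ] ℝ) => ζ.2.comp (A ζ.1)) ζ :=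
    contDiffAt_snd.clm_comp ((hA.of_le one_le_two).comp ζ contDiffAt_fst)
  have hid : IsLipschitzNear (fun ζ : E × (E →L[ℝ] ℝ) => ζ) ζ := contDiffAt_id.isLipschitzNear
  have hpair : IsLipschitzNear (fun ζ : E × (E →L[ℝ] ℝ) => (ζ, Y (ζ.2.comp (A ζ.1)))) ζ :=
    hid.prodMk (IsLipschitzNear.comp (f := fun ζ : E × (E →L[ℝ] ℝ) => ζ.2.comp (A ζ.1)) hY
      hb.isLipschitzNear)
  exact IsLipschitzNear.comp (f := fun ζ : E × (E →L[ℝ] ℝ) => (ζ, Y (ζ.2.comp (A ζ.1))))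
    (contDiffAt_hamiltonianField hA).isLipschitzNear hpair

/-- The derivative is written as the symplectic pairing with the Hamiltonian vector of the frozen
field `ξ ↦ A ξ y`. No derivative of the maximizer enters, since the derivative of `N` is evaluation
at `y`. -/
lemma hasFDerivAt_comp_frame {N : (E →L[ℝ] ℝ) → ℝ} {y : E} {ζ : E × (E →L[ℝ] ℝ)}
    (hA : DifferentiableAt ℝ A ζ.1)
    (hN : HasFDerivAt N (ContinuousLinearMap.apply ℝ ℝ y) (ζ.2.comp (A ζ.1))) :
    HasFDerivAt (fun ζ : E × (E →L[ℝ] ℝ) => N (ζ.2.comp (A ζ.1)))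
      ((ContinuousLinearMap.apply ℝ ℝ (A ζ.1 y)).comp (ContinuousLinearMap.snd ℝ _ _) -
        (-(ζ.2.comp ((fderiv ℝ A ζ.1).flip y))).comp (ContinuousLinearMap.fst ℝ _ _)) ζ := by
  have hfst : HasFDerivAt (fun ζ : E × (E →L[ℝ] ℝ) => ζ.1)
    (ContinuousLinearMap.fst ℝ _ _) ζ := hasFDerivAt_fst
  have hsnd : HasFDerivAt (fun ζ : E × (E →L[ℝ] ℝ) => ζ.2)
    (ContinuousLinearMap.snd ℝ _ _) ζ := hasFDerivAt_snd
  have hb := hsnd.clm_comp (hA.hasFDerivAt.comp ζ hfst)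
  refine (hN.comp ζ hb).congr_fderiv (ContinuousLinearMap.ext fun z => ?_)
  simp
  ring

end LinearFrame

/-! ### The maximized Hamiltonian of `F`, differentiated in a local frame. -/

section DualFinsler

variable {n : ℕ} {M : Type*} [TopologicalSpace M] [ChartedSpace (EuclideanSpace ℝ (Fin n)) M]
  [IsManifold (𝓡 n) ∞ M] {F : TangentBundle (𝓡 n) M → ℝ}
  {φ : OpenPartialHomeomorph M (EuclideanSpace ℝ (Fin n))}

/-- The Hamiltonian `(x, α) ↦ max {α(y) ; F(x, y) = 1}` of a Finsler structure. -/
def dualFinsler (F : TangentBundle (𝓡 n) M → ℝ) (p : CotangentBundle (n := n) M) : ℝ :=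
  sSup {r | ∃ y : TangentSpace (𝓡 n) p.1, F ⟨p.1, y⟩ = 1 ∧
    (p.2 : TangentSpace (𝓡 n) p.1 →L[ℝ] ℝ) y = r}

lemma isGreatest_of_isUnitMaximizer (hφ : φ ∈ IsManifold.maximalAtlas (𝓡 n) ∞ M)
    {ζ : EuclideanSpace ℝ (Fin n) × DualModel n} (hζ : ζ.1 ∈ φ.target)
    {y : EuclideanSpace ℝ (Fin n)} (hy : IsUnitMaximizer (coordFinsler F φ ζ.1) ζ.2 y) :
    IsGreatest {r | ∃ y : TangentSpace (𝓡 n) (φ.symm ζ.1), F ⟨φ.symm ζ.1, y⟩ = 1 ∧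
      ((cotangentCoordSymm φ ζ).2 : TangentSpace (𝓡 n) (φ.symm ζ.1) →L[ℝ] ℝ) y = r} (ζ.2 y) := by
  refine ⟨⟨mfderiv (𝓡 n) (𝓡 n) φ.symm ζ.1 y, hy.1,
    congrArg ζ.2 (mfderiv_chart_apply_mfderiv_symm hφ hζ y)⟩, ?_⟩
  rintro _ ⟨Y, hY, rfl⟩
  refine hy.2 (mfderiv (𝓡 n) (𝓡 n) φ (φ.symm ζ.1) Y) ?_
  rw [apply_eq_coordFinsler_mfderiv (F := F) hφ (φ.map_target hζ) Y, φ.right_inv hζ] at hY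
  exact hY

lemma dualFinsler_cotangentCoordSymm (hφ : φ ∈ IsManifold.maximalAtlas (𝓡 n) ∞ M)
    {ζ : EuclideanSpace ℝ (Fin n) × DualModel n} (hζ : ζ.1 ∈ φ.target)
    {y : EuclideanSpace ℝ (Fin n)} (hy : IsUnitMaximizer (coordFinsler F φ ζ.1) ζ.2 y) :
    dualFinsler F (cotangentCoordSymm φ ζ) = ζ.2 y :=
  (isGreatest_of_isUnitMaximizer hφ hζ hy).csSup_eq

/-- Near a nonzero covector, the Hamiltonian of a strongly convex Finsler structure with local
frames is differentiable, and its Hamiltonian vector field is Lipschitz. -/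
lemma exists_hamiltonianField (hF : IsC0Finsler F) (hφ : φ ∈ IsManifold.maximalAtlas (𝓡 n) ∞ M)
    {ζ₀ : EuclideanSpace ℝ (Fin n) × DualModel n} (hζ₀ : ζ₀.1 ∈ φ.target) (hζ₀' : ζ₀.2 ≠ 0)
    (hconv : IsStronglyConvexAsymmetricNorm
      (fun y : TangentSpace (𝓡 n) (φ.symm ζ₀.1) => F ⟨φ.symm ζ₀.1, y⟩))
    (hframe : HasLocalFrameAt F φ (φ.symm ζ₀.1)) :
    ∃ W : EuclideanSpace ℝ (Fin n) × DualModel n → EuclideanSpace ℝ (Fin n) × DualModel n,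
      IsLipschitzNear W ζ₀ ∧
      ∀ᶠ ζ in 𝓝 ζ₀, HasFDerivAt (fun ζ => dualFinsler F (cotangentCoordSymm φ ζ))
        (symplecticPairing (W ζ)) ζ := by
  obtain ⟨A, U, hUo, hpU, hUt, hA, hAF⟩ := hframe
  rw [φ.right_inv hζ₀] at hpU hAF
  set N := coordFinsler F φ ζ₀.1
  have hN : IsStronglyConvexAsymmetricNorm N := hconv.coordFinsler hφ hζ₀
  have hAsymm : ∀ ξ ∈ U, IsAsymmetricNorm (coordFinsler F φ ξ) := fun ξ hξ =>
    (hF.asymmetricNorm _).coordFinsler hφ (hUt hξ)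
  have hAbij : ∀ ξ ∈ U, Function.Bijective (A ξ) := fun ξ hξ =>
    hN.1.bijective_of_comp_eq (hAsymm ξ hξ) (hAF ξ hξ)
  have hcd : ∀ ξ ∈ U, ContDiffAt ℝ 2 A ξ := fun ξ hξ => hA.contDiffAt (hUo.mem_nhds hξ)
  have hb0 : ∀ ζ : EuclideanSpace ℝ (Fin n) × DualModel n, ζ.1 ∈ U → ζ.2 ≠ 0 →
      ζ.2.comp (A ζ.1) ≠ 0 := by
    intro ζ hζ hζ' h
    refine hζ' (ContinuousLinearMap.ext fun v => ?_)
    obtain ⟨v, rfl⟩ := (hAbij _ hζ).2 v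
    exact DFunLike.congr_fun h v
  -- The maximizer for `(ξ, α)` is the image under `A ξ` of the maximizer of `α ∘ A ξ` on the fixed
  -- unit sphere of `N`.
  have hdual : ∀ ζ : EuclideanSpace ℝ (Fin n) × DualModel n, ζ.1 ∈ U → ζ.2 ≠ 0 →
      dualFinsler F (cotangentCoordSymm φ ζ) =
        ζ.2.comp (A ζ.1) (unitMaximizer N (ζ.2.comp (A ζ.1))) := by
    intro ζ hζ hζ'
    have hmax := isUnitMaximizer_unitMaximizer hN.1 (hb0 ζ hζ hζ')
    refine dualFinsler_cotangentCoordSymm hφ (hUt hζ) ⟨(hAF _ hζ _).trans hmax.1, fun z hz => ?_⟩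
    obtain ⟨z, rfl⟩ := (hAbij _ hζ).2 z
    exact hmax.2 z (by rwa [hAF _ hζ] at hz)
  have hnhds : ∀ᶠ ζ : EuclideanSpace ℝ (Fin n) × DualModel n in 𝓝 ζ₀, ζ.1 ∈ U ∧ ζ.2 ≠ 0 :=
    (continuousAt_fst.eventually (hUo.mem_nhds hpU)).and
      (continuousAt_snd.eventually (isOpen_ne.mem_nhds hζ₀'))
  refine ⟨fun ζ => (A ζ.1 (unitMaximizer N (ζ.2.comp (A ζ.1))),
    -(ζ.2.comp ((fderiv ℝ A ζ.1).flip (unitMaximizer N (ζ.2.comp (A ζ.1)))))), ?_, ?_⟩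
  · exact isLipschitzNear_hamiltonianField (hcd _ hpU)
      (hN.locallyLipschitzOn_unitMaximizer _ (hb0 _ hpU hζ₀'))
  -- Differentiability at `ζ` needs the formula `hdual` on a whole neighbourhood of `ζ`.
  · filter_upwards [hnhds.eventually_nhds] with ζ hζ
    obtain ⟨hζU, hζ0⟩ := hζ.self_of_nhds
    have h := hasFDerivAt_comp_frame (N := fun b => b (unitMaximizer N b))
      ((hcd _ hζU).differentiableAt two_ne_zero)
      (hN.hasFDerivAt_apply_unitMaximizer (hb0 ζ hζU hζ0))
    exact h.congr_of_eventuallyEq (hζ.mono fun ζ h => hdual ζ h.1 h.2)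

end DualFinsler

/-! ### The Hamiltonian vector field on the cotangent bundle, and its identification with the
extended geodesic field. -/

section HamiltonianField

variable {n : ℕ} {M : Type*} [TopologicalSpace M] [ChartedSpace (EuclideanSpace ℝ (Fin n)) M]
  [IsManifold (𝓡 n) ∞ M] {F : TangentBundle (𝓡 n) M → ℝ}
  {φ : OpenPartialHomeomorph M (EuclideanSpace ℝ (Fin n))}

lemma cotangentCoord_snd_ne_zero (hφ : φ ∈ IsManifold.maximalAtlas (𝓡 n) ∞ M)
    {p : CotangentBundle (n := n) M} (hp : p.1 ∈ φ.source) (hp0 : p.2 ≠ 0) :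
    (cotangentCoord φ p).2 ≠ 0 := by
  intro h
  refine hp0 (ContinuousLinearMap.ext fun v => ?_)
  have h1 := DFunLike.congr_fun h (mfderiv (𝓡 n) (𝓡 n) φ p.1 v : EuclideanSpace ℝ (Fin n))
  refine Eq.trans (congrArg (p.2 : EuclideanSpace ℝ (Fin n) →L[ℝ] ℝ) ?_) h1
  refine (mfderiv_chart_symm_apply_mfderiv hφ hp v).symm.trans ?_
  exact (congrArg (fun L : EuclideanSpace ℝ (Fin n) →L[ℝ] EuclideanSpace ℝ (Fin n) =>
    L (mfderiv (𝓡 n) (𝓡 n) φ p.1 v)) (inverse_mfderiv_chart hφ hp)).symm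

lemma cotangentCoordSymm_snd_ne_zero (hφ : φ ∈ IsManifold.maximalAtlas (𝓡 n) ∞ M)
    {ζ : EuclideanSpace ℝ (Fin n) × DualModel n} (hζ : ζ.1 ∈ φ.target) (hζ0 : ζ.2 ≠ 0) :
    (cotangentCoordSymm φ ζ).2 ≠ 0 := by
  intro h
  refine hζ0 (ContinuousLinearMap.ext fun v => ?_)
  refine Eq.trans (congrArg ζ.2 (mfderiv_chart_apply_mfderiv_symm hφ hζ v).symm) ?_
  exact congrArg (fun L : EuclideanSpace ℝ (Fin n) →L[ℝ] ℝ =>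
    L (mfderiv (𝓡 n) (𝓡 n) φ.symm ζ.1 v)) h

/-- The components of a tangent vector of `T*M` in natural coordinates are obtained by applying
the derivative of the transition map from the preferred chart, which is symplectic. -/
lemma exists_hasFDerivAt_cotangentComponents (hφ : φ ∈ IsManifold.maximalAtlas (𝓡 n) ∞ M)
    {p : CotangentBundle (n := n) M} (hp : p.1 ∈ φ.source) :
    ∃ D : EuclideanSpace ℝ (Fin n) × DualModel n →L[ℝ] EuclideanSpace ℝ (Fin n) × DualModel n,
      HasFDerivAt (cotangentTransition (chartAt (EuclideanSpace ℝ (Fin n)) p.1) φ) D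
        (cotangentCoord (chartAt (EuclideanSpace ℝ (Fin n)) p.1) p) ∧
      (∀ w z, symplecticPairing (D w) (D z) = symplecticPairing w z) ∧
      Function.Bijective D ∧
      ∀ w : EuclideanSpace ℝ (Fin n) × DualModel n, cotangentComponents φ p w = D w := by
  have hl : (chartAt (EuclideanSpace ℝ (Fin n)) p.1).symm
      (cotangentCoord (chartAt (EuclideanSpace ℝ (Fin n)) p.1) p).1 = p.1 :=
    (chartAt (EuclideanSpace ℝ (Fin n)) p.1).left_inv (mem_chart_source _ p.1)
  obtain ⟨D, hD, hsymp⟩ := exists_hasFDerivAt_cotangentTransition (ψ := φ)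
    (IsManifold.chart_mem_maximalAtlas (I := 𝓡 n) (n := ∞) p.1) hφ
    (ζ := cotangentCoord (chartAt (EuclideanSpace ℝ (Fin n)) p.1) p) (by rwa [hl])
    ((chartAt (EuclideanSpace ℝ (Fin n)) p.1).map_source (mem_chart_source _ p.1))
  have hinj : Function.Injective D := fun w w' h => symplecticPairing_injective
    (ContinuousLinearMap.ext fun z => by rw [← hsymp, h, hsymp])
  exact ⟨D, hD, hsymp, ⟨hinj, LinearMap.surjective_of_injective (f := D.toLinearMap) hinj⟩,
    fun w => DFunLike.congr_fun (hasMFDerivAt_cotangentCoord hφ hp hD).mfderiv w⟩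

lemma cotangentComponents_injective (hφ : φ ∈ IsManifold.maximalAtlas (𝓡 n) ∞ M)
    {p : CotangentBundle (n := n) M} (hp : p.1 ∈ φ.source) :
    Function.Injective (cotangentComponents φ p) := by
  obtain ⟨D, -, -, hbij, hcomp⟩ := exists_hasFDerivAt_cotangentComponents hφ hp
  exact fun w w' h => hbij.1 ((hcomp w).symm.trans (h.trans (hcomp w')))

open Classical in
/-- The Hamiltonian vector of the Hamiltonian of `F` at `p` (and `0` if the Hamiltonian is not
differentiable at `p`). -/
def hamiltonianVector (F : TangentBundle (𝓡 n) M → ℝ) (p : CotangentBundle (n := n) M) :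
    TangentSpace (cotangentModel n) p :=
  if h : ∃ w : EuclideanSpace ℝ (Fin n) × DualModel n,
      HasFDerivAt (fun ζ => dualFinsler F
          (cotangentCoordSymm (chartAt (EuclideanSpace ℝ (Fin n)) p.1) ζ))
        (symplecticPairing w) (cotangentCoord (chartAt (EuclideanSpace ℝ (Fin n)) p.1) p)
  then h.choose else (0 : EuclideanSpace ℝ (Fin n) × DualModel n)

/-- In all natural coordinates, the components of the Hamiltonian vector are given by Hamilton's
equations. -/
lemma hasFDerivAt_dualFinsler (hF : IsC0Finsler F)
    (hconv : ∀ x : M,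
      IsStronglyConvexAsymmetricNorm (fun y : TangentSpace (𝓡 n) x => F ⟨x, y⟩))
    (hframe : ∀ φ ∈ IsManifold.maximalAtlas (𝓡 n) ∞ M, ∀ x ∈ φ.source, HasLocalFrameAt F φ x)
    (hφ : φ ∈ IsManifold.maximalAtlas (𝓡 n) ∞ M)
    {p : CotangentBundle (n := n) M} (hp : p.1 ∈ φ.source) (hp0 : p.2 ≠ 0) :
    HasFDerivAt (fun ζ => dualFinsler F (cotangentCoordSymm φ ζ))
      (symplecticPairing (cotangentComponents φ p (hamiltonianVector F p)))
      (cotangentCoord φ p) := by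
  have hex : ∀ ψ ∈ IsManifold.maximalAtlas (𝓡 n) ∞ M, p.1 ∈ ψ.source →
      ∃ w, HasFDerivAt (fun ζ => dualFinsler F (cotangentCoordSymm ψ ζ))
        (symplecticPairing w) (cotangentCoord ψ p) := by
    intro ψ hψ hpψ
    have ht : (cotangentCoord ψ p).1 ∈ ψ.target := ψ.map_source hpψ
    obtain ⟨W, -, hW⟩ := exists_hamiltonianField hF hψ ht (cotangentCoord_snd_ne_zero hψ hpψ hp0)
      (hconv _) (hframe ψ hψ _ (ψ.map_target ht))
    exact ⟨_, hW.self_of_nhds⟩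
  set c := chartAt (EuclideanSpace ℝ (Fin n)) p.1
  have hc : c ∈ IsManifold.maximalAtlas (𝓡 n) ∞ M :=
    IsManifold.chart_mem_maximalAtlas (I := 𝓡 n) (n := ∞) p.1
  have hpc : p.1 ∈ c.source := mem_chart_source _ p.1
  have hv : HasFDerivAt (fun ζ => dualFinsler F (cotangentCoordSymm c ζ))
      (symplecticPairing (hamiltonianVector F p)) (cotangentCoord c p) := by
    have h := hex c hc hpc
    have h' : hamiltonianVector F p = h.choose := dif_pos h
    rw [h']
    exact h.choose_spec
  obtain ⟨w, hw⟩ := hex φ hφ hp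
  obtain ⟨D, hD, hsymp, hbij, hcomp⟩ := exists_hasFDerivAt_cotangentComponents hφ hp
  have hl : c.symm (cotangentCoord c p).1 = p.1 := c.left_inv hpc
  have hT : cotangentTransition c φ (cotangentCoord c p) = cotangentCoord φ p := by
    rw [← cotangentCoord_cotangentCoordSymm_eq_transition hc hφ (by rwa [hl]) (c.map_source hpc),
      cotangentCoordSymm_cotangentCoord hc hpc]
  rw [← hT] at hw
  have hnhds : ∀ᶠ ζ : EuclideanSpace ℝ (Fin n) × DualModel n in 𝓝 (cotangentCoord c p),
      ζ.1 ∈ c.target ∧ c.symm ζ.1 ∈ φ.source :=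
    continuousAt_fst.eventually (chart_transition_nhds (c.map_source hpc) (by rwa [hl]))
  -- The Hamiltonian read in `c` is the one read in `φ` composed with the transition map, so its
  -- derivative is computed in two ways.
  have heq := hv.unique ((hw.comp _ hD).congr_of_eventuallyEq (hnhds.mono fun ζ hζ => by
    rw [Function.comp_apply, cotangentCoordSymm_cotangentTransition hc hφ hζ.2 hζ.1]))
  -- Since `D` preserves the pairing and is onto, the vector representing the differential in `φ` is
  -- the image under `D` of the one in `c`.
  have hw' : w = cotangentComponents φ p (hamiltonianVector F p) := by
    refine symplecticPairing_injective (ContinuousLinearMap.ext fun z => ?_)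
    obtain ⟨z, rfl⟩ := hbij.2 z
    exact (DFunLike.congr_fun heq z).symm.trans ((hsymp _ z).symm.trans
      (congrArg (fun w => symplecticPairing w (D z)) (hcomp _).symm))
  rw [hT] at hw
  exact hw' ▸ hw

/-- The Hamiltonian vector field of a strongly convex Finsler structure with local frames is
locally Lipschitz away from the zero section. -/
lemma isLocallyLipschitzOffZero_hamiltonianVector (hF : IsC0Finsler F)
    (hconv : ∀ x : M,
      IsStronglyConvexAsymmetricNorm (fun y : TangentSpace (𝓡 n) x => F ⟨x, y⟩))
    (hframe : ∀ φ ∈ IsManifold.maximalAtlas (𝓡 n) ∞ M, ∀ x ∈ φ.source, HasLocalFrameAt F φ x) :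
    IsLocallyLipschitzOffZero (hamiltonianVector F) := by
  intro φ hφ ζ₀ hζ₀
  obtain ⟨W, ⟨K, t, ht, hK⟩, hW⟩ := exists_hamiltonianField hF hφ hζ₀.1 hζ₀.2 (hconv _)
    (hframe φ hφ _ (φ.map_target hζ₀.1))
  refine ⟨K, t ∩ {ζ | HasFDerivAt (fun ζ => dualFinsler F (cotangentCoordSymm φ ζ))
    (symplecticPairing (W ζ)) ζ} ∩ φ.target ×ˢ {0}ᶜ, ?_, ?_⟩
  · exact Filter.inter_mem (mem_nhdsWithin_of_mem_nhds (Filter.inter_mem ht hW))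
      self_mem_nhdsWithin
  -- Uniqueness of the derivative together with nondegeneracy identifies the components with the
  -- Lipschitz local model `W`.
  · have heq : ∀ ζ ∈ t ∩ {ζ | HasFDerivAt (fun ζ => dualFinsler F (cotangentCoordSymm φ ζ))
        (symplecticPairing (W ζ)) ζ} ∩ φ.target ×ˢ {0}ᶜ,
        cotangentComponents φ (cotangentCoordSymm φ ζ)
          (hamiltonianVector F (cotangentCoordSymm φ ζ)) = W ζ := by
      intro ζ hζ
      have h := hasFDerivAt_dualFinsler hF hconv hframe hφ
        (p := cotangentCoordSymm φ ζ) (φ.map_target hζ.2.1)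
        (cotangentCoordSymm_snd_ne_zero hφ hζ.2.1 hζ.2.2)
      rw [cotangentCoord_cotangentCoordSymm hφ hζ.2.1] at h
      exact symplecticPairing_injective (h.unique hζ.1.2)
    intro ζ hζ ζ' hζ'
    simp only [heq ζ hζ, heq ζ' hζ']
    exact hK hζ.1.1 hζ'.1.1

/-- The extended geodesic field of every admissible family is the Hamiltonian vector field. -/
lemma extendedGeodesicField_eq_singleton (hF : IsC0Finsler F)
    (hconv : ∀ x : M,
      IsStronglyConvexAsymmetricNorm (fun y : TangentSpace (𝓡 n) x => F ⟨x, y⟩))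
    (hframe : ∀ φ ∈ IsManifold.maximalAtlas (𝓡 n) ∞ M, ∀ x ∈ φ.source, HasLocalFrameAt F φ x)
    (hφ : φ ∈ IsManifold.maximalAtlas (𝓡 n) ∞ M)
    {X : Metric.sphere (0 : EuclideanSpace ℝ (Fin n)) 1 → (x : M) → TangentSpace (𝓡 n) x}
    (hX : IsPontryaginFamily F φ X)
    {p : CotangentBundle (n := n) M} (hp : p.1 ∈ φ.source) (hp0 : p.2 ≠ 0) :
    extendedGeodesicField φ X p = {hamiltonianVector F p} := by
  -- The controls sweep out exactly the unit sphere of `F`, so maximizing over controls gives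
  -- `dualFinsler`, whatever the family.
  have hgreatest : ∀ q : CotangentBundle (n := n) M, q.1 ∈ φ.source → q.2 ≠ 0 →
      ∃ u, (∀ v, controlHamiltonian X v q ≤ controlHamiltonian X u q) ∧
        controlHamiltonian X u q = dualFinsler F q := by
    intro q hq hq0
    have ht : (cotangentCoord φ q).1 ∈ φ.target := φ.map_source hq
    have hN : IsAsymmetricNorm (coordFinsler F φ (cotangentCoord φ q).1) :=
      (hF.asymmetricNorm _).coordFinsler hφ ht
    obtain ⟨y, hy⟩ := exists_isUnitMaximizer hN (cotangentCoord_snd_ne_zero hφ hq hq0)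
    have h1 := isGreatest_of_isUnitMaximizer hφ ht hy
    have h2 : IsGreatest {r | ∃ y : TangentSpace (𝓡 n) q.1, F ⟨q.1, y⟩ = 1 ∧
        (q.2 : TangentSpace (𝓡 n) q.1 →L[ℝ] ℝ) y = r} ((cotangentCoord φ q).2 y) := by
      have h3 := cotangentCoordSymm_cotangentCoord hφ hq
      have h4 : ∀ q' : CotangentBundle (n := n) M, q' = q →
        IsGreatest {r | ∃ y : TangentSpace (𝓡 n) q'.1, F ⟨q'.1, y⟩ = 1 ∧
          (q'.2 : TangentSpace (𝓡 n) q'.1 →L[ℝ] ℝ) y = r} ((cotangentCoord φ q).2 y) →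
        IsGreatest {r | ∃ y : TangentSpace (𝓡 n) q.1, F ⟨q.1, y⟩ = 1 ∧
          (q.2 : TangentSpace (𝓡 n) q.1 →L[ℝ] ℝ) y = r} ((cotangentCoord φ q).2 y) := by
        rintro _ rfl h; exact h
      exact h4 _ h3 h1
    have hunit : ∀ v, F ⟨q.1, X v q.1⟩ = 1 := fun v =>
      (hX.range_eq q.1 hq).subset ⟨v, rfl⟩
    obtain ⟨Y, hY, hYr⟩ := h2.1
    obtain ⟨u, hu⟩ := (hX.range_eq q.1 hq).superset hY
    have hval : controlHamiltonian X u q = (cotangentCoord φ q).2 y := by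
      rw [← hYr, ← hu]; rfl
    refine ⟨u, fun v => ?_, hval.trans h2.csSup_eq.symm⟩
    rw [hval]
    exact h2.2 ⟨X v q.1, hunit v, rfl⟩
  have hle : ∀ u, ∀ q : CotangentBundle (n := n) M, q.1 ∈ φ.source → q.2 ≠ 0 →
      controlHamiltonian X u q ≤ dualFinsler F q := by
    intro u q hq hq0
    obtain ⟨v, hv, hv'⟩ := hgreatest q hq hq0
    exact hv' ▸ hv u
  have hcomp : ∀ u ∈ maximizingControls X p,
      cotangentComponents φ p (hamiltonianVector F p) =
        hamiltonianComponents φ (X u) (cotangentCoord φ p) := by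
    intro u hu
    set ζ₀ := cotangentCoord φ p
    have ht : ζ₀.1 ∈ φ.target := φ.map_source hp
    have hmax : controlHamiltonian X u p = dualFinsler F p := by
      obtain ⟨v, hv, hv'⟩ := hgreatest p hp hp0
      exact le_antisymm (hle u p hp hp0) (hv' ▸ hu v)
    have hf := ((((hX.contDiffOn u).contDiffAt (φ.open_target.mem_nhds ht)).differentiableAt
      (by simp)).hasFDerivAt)
    have hfst : HasFDerivAt (fun ζ : EuclideanSpace ℝ (Fin n) × DualModel n => ζ.1)
      (ContinuousLinearMap.fst ℝ _ _) ζ₀ := hasFDerivAt_fst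
    have hsnd : HasFDerivAt (fun ζ : EuclideanSpace ℝ (Fin n) × DualModel n => ζ.2)
      (ContinuousLinearMap.snd ℝ _ _) ζ₀ := hasFDerivAt_snd
    have hHu : HasFDerivAt (fun ζ => controlHamiltonian X u (cotangentCoordSymm φ ζ))
        (symplecticPairing (hamiltonianComponents φ (X u) ζ₀)) ζ₀ := by
      refine (hsnd.clm_apply (hf.comp ζ₀ hfst)).congr_fderiv (ContinuousLinearMap.ext fun z => ?_)
      simp [hamiltonianComponents]
      ring
    have hH := hasFDerivAt_dualFinsler hF hconv hframe hφ hp hp0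
    -- Here `u` stays fixed while the covector varies: the difference is nonnegative off the zero
    -- section and vanishes at `p`, so the two differentials agree there.
    have hmin : IsLocalMin (fun ζ => dualFinsler F (cotangentCoordSymm φ ζ) -
        controlHamiltonian X u (cotangentCoordSymm φ ζ)) ζ₀ := by
      have h0 : cotangentCoordSymm φ ζ₀ = p := cotangentCoordSymm_cotangentCoord hφ hp
      have hnhds : ∀ᶠ ζ : EuclideanSpace ℝ (Fin n) × DualModel n in 𝓝 ζ₀,
          ζ.1 ∈ φ.target ∧ ζ.2 ≠ 0 :=
        (continuousAt_fst.eventually (φ.open_target.mem_nhds ht)).and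
          (continuousAt_snd.eventually (isOpen_ne.mem_nhds (cotangentCoord_snd_ne_zero hφ hp hp0)))
      filter_upwards [hnhds] with ζ hζ
      rw [h0, hmax, sub_self, sub_nonneg]
      exact hle u _ (φ.map_target hζ.1) (cotangentCoordSymm_snd_ne_zero hφ hζ.1 hζ.2)
    exact symplecticPairing_injective (sub_eq_zero.1 (hmin.hasFDerivAt_eq_zero (hH.sub hHu)))
  refine Set.Subset.antisymm ?_ (Set.singleton_subset_iff.2 ?_)
  · rintro w ⟨u, hu, hw⟩
    exact cotangentComponents_injective hφ hp (hw.trans (hcomp u hu).symm)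
  · obtain ⟨u, hu, -⟩ := hgreatest p hp hp0
    exact ⟨u, hu, hcomp u hu⟩

end HamiltonianField

end

theorem mainTheorem5 {m n : ℕ} {G : Type*} [Group G] [TopologicalSpace G]
    [ChartedSpace (EuclideanSpace ℝ (Fin m)) G] [LieGroup (𝓡 m) ∞ G]
    (H : Subgroup G) (hH : IsClosed (H : Set G))
    -- the smooth structure of `G ⧸ H`: the unique one for which the projection is a submersion
    [ChartedSpace (EuclideanSpace ℝ (Fin n)) (G ⧸ H)] [IsManifold (𝓡 n) ∞ (G ⧸ H)]
    (hπ : Manifold.IsSubmersion (𝓡 m) (𝓡 n) ∞ (QuotientGroup.mk : G → G ⧸ H))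
    (F : TangentBundle (𝓡 n) (G ⧸ H) → ℝ) (hF : IsC0Finsler F)
    (hinv : ∀ (g : G) (v : TangentBundle (𝓡 n) (G ⧸ H)),
      F (tangentMap (𝓡 n) (𝓡 n) (fun x : G ⧸ H => g • x) v) = F v) :
    IsPontryaginType F ∧
    ((∃ x : G ⧸ H,
        IsStronglyConvexAsymmetricNorm (fun y : TangentSpace (𝓡 n) x => F ⟨x, y⟩)) →
      ∃ V : (p : CotangentBundle (n := n) (G ⧸ H)) → TangentSpace (cotangentModel n) p,
        IsLocallyLipschitzOffZero V ∧
        ∀ φ ∈ IsManifold.maximalAtlas (𝓡 n) ∞ (G ⧸ H),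
        ∀ X : Metric.sphere (0 : EuclideanSpace ℝ (Fin n)) 1 →
            (x : G ⧸ H) → TangentSpace (𝓡 n) x,
          IsPontryaginFamily F φ X →
          ∀ p : CotangentBundle (n := n) (G ⧸ H), p.1 ∈ φ.source → p.2 ≠ 0 →
            extendedGeodesicField φ X p = {V p}) := by
  have hframe : ∀ φ ∈ IsManifold.maximalAtlas (𝓡 n) ∞ (G ⧸ H), ∀ x ∈ φ.source,
      HasLocalFrameAt F φ x := fun φ hφ x hx => hasLocalFrameAt_of_invariant hπ hinv hφ hx
  refine ⟨fun p => ?_, fun ⟨x, hx⟩ => ?_⟩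
  · have hc : chartAt (EuclideanSpace ℝ (Fin n)) p ∈ IsManifold.maximalAtlas (𝓡 n) ∞ (G ⧸ H) :=
      IsManifold.chart_mem_maximalAtlas (I := 𝓡 n) (n := ∞) p
    exact isPontryaginTypeAt_of_hasLocalFrameAt hF hc (mem_chart_source _ p)
      (hframe _ hc _ (mem_chart_source _ p))
  · have hconv := isStronglyConvexAsymmetricNorm_of_invariant hπ hinv hx
    exact ⟨hamiltonianVector F, isLocallyLipschitzOffZero_hamiltonianVector hF hconv hframe,
      fun φ hφ X hX p hp hp0 => extendedGeodesicField_eq_singleton hF hconv hframe hφ hX hp hp0⟩
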